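/- Let $j\ge 1$ and let $n_1,\dots,n_j\ge 1$ be integers, $n=n_1+\dots+n_j$, and write $\mathbb{R}^n=\mathbb{R}^{n_1}\times\dots\times\mathbb{R}^{n_j}$. For $\mathbf{s}=(s_1,\dots,s_j)\in\mathbb{R}^j$ let $\mathcal{H}^{\mathbf{s}}=\mathcal{H}^{\mathbf{s}}(\mathbb{R}^n)$ be the space of all $u\in\mathcal{S}'(\mathbb{R}^n)$ such that $$\langle\langle D\rangle\rangle^{\mathbf{s}}u=(1-\Delta_{\mathbb{R}^{n_1}})^{s_1/2}\otimes\dots\otimes(1-\Delta_{\mathbb{R}^{n_j}})^{s_j/2}u\in L^2(\mathbb{R}^n),$$ with the norm $\|u\|_{\mathcal{H}^{\mathbf{s}}}=\|\langle\langle D\rangle\rangle^{\mathbf{s}}u\|_{L^2}$. Let $\mathbf{s}\in\mathbb{R}^j$ and let $K\subset\mathbb{R}^n$ be a compact set with $(K-K)\cap\mathbb{Z}^n=\{0\}$. Then there is a constant $C\ge 1$ such that the following holds for every family $(u_\gamma)_{\gamma\in\mathbb{Z}^n}$ of elements of $\mathcal{H}^{\mathbf{s}}$ with $\operatorname{supp}u_\gamma\subset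 K$ for all $\gamma$. The sum $$u=\sum_{\gamma\in\mathbb{Z}^n}\tau_\gamma u_\gamma=\sum_{\gamma\in\mathbb{Z}^n}u_\gamma(\cdot-\gamma)$$ converges in $\mathcal{D}'(\mathbb{R}^n)$ (weakly, i.e. when tested against each test function), and the following statements are equivalent: (a) $u\in\mathcal{H}^{\mathbf{s}}$ (that is, $u$ is the restriction to test functions of an element of $\mathcal{H}^{\mathbf{s}}\subset\mathcal{S}'(\mathbb{R}^n)$); (b) $\sum_{\gamma\in\mathbb{Z}^n}\|u_\gamma\|_{\mathcal{H}^{\mathbf{s}}}^2<\infty$. Moreover, if these hold, then $$C^{-1}\|u\|_{\mathcal{H}^{\mathbf{s}}}\le\Big(\sum_{\gamma\in\mathbb{Z}^n}\|u_\gamma\|_{\mathcal{H}^{\mathbf{s}}}^2\Big)^{1/2}\le C\|u\|_{\mathcal{H}^{\mathbf{s}}}.$$ -/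

import Mathlib

open MeasureTheory
open scoped SchwartzMap Distributions Pointwise

noncomputable section

namespace AnisotropicSobolev

variable {j : ℕ}

/-- The space `ℝⁿ = ℝ^{d 0} × ⋯ × ℝ^{d (j-1)}`, with its Euclidean norm: the coordinates are indexed
by pairs (block, position in the block). -/
abbrev Space (d : Fin j → ℕ) : Type :=
  EuclideanSpace ℝ (Σ l : Fin j, Fin (d l))

/-- The orthogonal projection of `ℝⁿ` onto its `l`-th factor `ℝ^{d l}`. -/
def block (d : Fin j → ℕ) (l : Fin j) : Space d →L[ℝ] EuclideanSpace ℝ (Fin (d l)) :=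
  LinearMap.toContinuousLinearMap
    { toFun := fun x => WithLp.toLp 2 fun i => x ⟨l, i⟩
      map_add' := fun _ _ => rfl
      map_smul' := fun _ _ => rfl }

/-- `⟨⟨ξ⟩⟩^s = ∏ₗ (1 + |ξₗ|²)^{sₗ/2}`, where `ξₗ` is the component of `ξ` in the `l`-th factor. -/
def bracket (d : Fin j → ℕ) (s : Fin j → ℝ) (ξ : Space d) : ℝ :=
  ∏ l, (1 + ‖block d l ξ‖ ^ 2) ^ (s l / 2)

/-- The operator `⟨⟨D⟩⟩^s = (1 - Δ_{ℝ^{d 0}})^{s 0 / 2} ⊗ ⋯ ⊗ (1 - Δ_{ℝ^{d (j-1)}})^{s (j-1) / 2}`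
on tempered distributions. The Fourier transform of Mathlib has the kernel `exp (-2πi⟨x, ξ⟩)`, so
`D = -i∂` is the Fourier multiplier `2πξ`. -/
def bracketD (d : Fin j → ℕ) (s : Fin j → ℝ) : 𝓢'(Space d, ℂ) →L[ℂ] 𝓢'(Space d, ℂ) :=
  TemperedDistribution.fourierMultiplierCLM ℂ
    fun ξ => ((bracket d s ((2 * Real.pi) • ξ) : ℝ) : ℂ)

theorem block_apply (d : Fin j → ℕ) (l : Fin j) (x : Space d) (i : Fin (d l)) :
    block d l x i = x ⟨l, i⟩ := rfl

theorem bracket_hasTemperateGrowth (d : Fin j → ℕ) (s : Fin j → ℝ) :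
    (bracket d s).HasTemperateGrowth := by
  have h : ∀ l : Fin j,
      (fun ξ : Space d => (1 + ‖block d l ξ‖ ^ 2) ^ (s l / 2)).HasTemperateGrowth := fun l =>
    (Function.hasTemperateGrowth_one_add_norm_sq_rpow
      (EuclideanSpace ℝ (Fin (d l))) (s l / 2)).comp (block d l).hasTemperateGrowth
  have key : ∀ t : Finset (Fin j), (fun ξ : Space d =>
      ∏ l ∈ t, (1 + ‖block d l ξ‖ ^ 2) ^ (s l / 2)).HasTemperateGrowth := by
    classical
    intro t
    induction t using Finset.induction_on with
    | empty => simp only [Finset.prod_empty]; exact Function.HasTemperateGrowth.const (1 : ℝ)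
    | insert a t ha ih =>
      simp only [Finset.prod_insert ha]
      exact (h a).mul ih
  exact key Finset.univ

/-- The symbol of `⟨⟨D⟩⟩^s` has temperate growth, so that the multiplier is the genuine one. -/
theorem symbol_hasTemperateGrowth (d : Fin j → ℕ) (s : Fin j → ℝ) :
    (fun ξ : Space d => ((bracket d s ((2 * Real.pi) • ξ) : ℝ) : ℂ)).HasTemperateGrowth := by
  have h1 : (fun ξ : Space d => (2 * Real.pi) • ξ).HasTemperateGrowth :=
    ((2 * Real.pi) • ContinuousLinearMap.id ℝ (Space d)).hasTemperateGrowth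
  exact Function.HasTemperateGrowth.comp (g := Complex.ofReal)
    Complex.ofRealCLM.hasTemperateGrowth ((bracket_hasTemperateGrowth d s).comp h1)

/-- `v` belongs to `ℋ^s(ℝⁿ)`: the tempered distribution `⟨⟨D⟩⟩^s v` is an `L²` function. -/
def MemH {d : Fin j → ℕ} (s : Fin j → ℝ) (v : 𝓢'(Space d, ℂ)) : Prop :=
  ∃ f : Lp ℂ 2 (volume : Measure (Space d)), bracketD d s v = (f : 𝓢'(Space d, ℂ))

open Classical in
/-- The norm `‖v‖_{ℋ^s} = ‖⟨⟨D⟩⟩^s v‖_{L²}` of `v ∈ ℋ^s(ℝⁿ)` (and `0` for all other `v`). -/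
def normH {d : Fin j → ℕ} (s : Fin j → ℝ) (v : 𝓢'(Space d, ℂ)) : ℝ :=
  if h : MemH s v then ‖h.choose‖ else 0

/-- The norm does not depend on the choice of the representing `L²` function. -/
theorem normH_eq {d : Fin j → ℕ} {s : Fin j → ℝ} {v : 𝓢'(Space d, ℂ)}
    {f : Lp ℂ 2 (volume : Measure (Space d))} (hf : bracketD d s v = (f : 𝓢'(Space d, ℂ))) :
    normH s v = ‖f‖ := by
  have h : MemH s v := ⟨f, hf⟩
  have hc : (h.choose : 𝓢'(Space d, ℂ)) = f := h.choose_spec.symm.trans hf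
  have hinj : Function.Injective (Lp.toTemperedDistributionCLM ℂ (volume : Measure (Space d)) 2) :=
    LinearMap.ker_eq_bot.1 Lp.ker_toTemperedDistributionCLM_eq_bot
  have : h.choose = f := hinj hc
  rw [normH, dif_pos h, this]

/-- A real-valued test function, regarded as a complex-valued Schwartz function. -/
def testToSchwartzFun {d : Fin j → ℕ} (φ : 𝓓((⊤ : TopologicalSpace.Opens (Space d)), ℝ)) :
    𝓢(Space d, ℂ) :=
  (φ.hasCompactSupport.comp_left (g := Complex.ofReal) Complex.ofReal_zero).toSchwartzMap
    (Complex.ofRealCLM.contDiff.comp φ.contDiff)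

theorem testToSchwartzFun_apply {d : Fin j → ℕ}
    (φ : 𝓓((⊤ : TopologicalSpace.Opens (Space d)), ℝ)) (x : Space d) :
    testToSchwartzFun φ x = (φ x : ℂ) := rfl

/-- The inclusion `𝓓(ℝⁿ) → 𝓢(ℝⁿ)` of the (real-valued) test functions into the (complex-valued)
Schwartz functions, as a continuous linear map. -/
def testToSchwartz (d : Fin j → ℕ) :
    𝓓((⊤ : TopologicalSpace.Opens (Space d)), ℝ) →L[ℝ] 𝓢(Space d, ℂ) :=
  TestFunction.mkCLM ℝ testToSchwartzFun
    (fun φ ψ => by ext x; simp [testToSchwartzFun_apply])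
    (fun c φ => by ext x; simp [testToSchwartzFun_apply])
    (fun K hK => by
      let L : 𝓓^{⊤}_{K}(Space d, ℝ) →ₗ[ℝ] 𝓢(Space d, ℂ) :=
        { toFun := fun φ => testToSchwartzFun (TestFunction.ofSupportedIn hK φ)
          map_add' := fun φ ψ => by ext x; simp [testToSchwartzFun_apply]
          map_smul' := fun c φ => by ext x; simp [testToSchwartzFun_apply] }
      change Continuous L
      refine WithSeminorms.continuous_of_isBounded
        (ContDiffMapSupportedIn.withSeminorms ℝ (Space d) ℝ ⊤ K)
        (schwartz_withSeminorms ℝ (Space d) ℂ) L (Seminorm.IsBounded.of_real ?_)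
      rintro ⟨k, m⟩
      obtain ⟨R, hR⟩ := K.isCompact.isBounded.exists_norm_le
      refine ⟨{m}, |R| ^ k, fun φ => ?_⟩
      simp only [Finset.sup_singleton]
      refine SchwartzMap.seminorm_le_bound ℝ k m _ (by positivity) fun x => ?_
      have h1 : ‖iteratedFDeriv ℝ m (L φ) x‖ = ‖iteratedFDeriv ℝ m φ x‖ :=
        Complex.ofRealLI.norm_iteratedFDeriv_comp_left (φ.contDiff.contDiffAt) (mod_cast le_top)
      rw [h1]
      by_cases hx : x ∈ K
      · gcongr
        · exact (hR x hx).trans (le_abs_self R)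
        · exact ContDiffMapSupportedIn.norm_iteratedFDeriv_apply_le_seminorm_top ℝ
      · have h0 : iteratedFDeriv ℝ m φ x = 0 := φ.iteratedFDeriv_zero_on_compl hx
        rw [h0, norm_zero, mul_zero]
        positivity)

theorem testToSchwartz_apply (d : Fin j → ℕ)
    (φ : 𝓓((⊤ : TopologicalSpace.Opens (Space d)), ℝ)) (x : Space d) :
    testToSchwartz d φ x = (φ x : ℂ) := rfl

/-- The distribution on `ℝⁿ` given by a tempered distribution, that is, the inclusion
`𝓢'(ℝⁿ) → 𝓓'(ℝⁿ)`. -/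
def toDistribution {d : Fin j → ℕ} (v : 𝓢'(Space d, ℂ)) :
    𝓓'((⊤ : TopologicalSpace.Opens (Space d)), ℂ) :=
  { toFun := fun φ => v (testToSchwartz d φ)
    map_add' := fun φ ψ => by simp
    map_smul' := fun c φ => by
      rw [map_smul]
      exact v.map_smul_of_tower c _
    cont := v.continuous.comp (testToSchwartz d).continuous }

/-- The translate `τ_a v = v(· - a)` of a tempered distribution: `(τ_a v)(φ) = v(φ(· + a))`. -/
def translate {d : Fin j → ℕ} (a : Space d) : 𝓢'(Space d, ℂ) →L[ℂ] 𝓢'(Space d, ℂ) :=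
  PointwiseConvergenceCLM.precomp ℂ (SchwartzMap.compSubConstCLM ℂ (-a))

theorem translate_apply_apply {d : Fin j → ℕ} (a : Space d) (v : 𝓢'(Space d, ℂ))
    (φ : 𝓢(Space d, ℂ)) : translate a v φ = v (φ.compSubConstCLM ℂ (-a)) := rfl

/-- The point of `ℝⁿ` with the integer coordinates `γ`. -/
def latticePoint {d : Fin j → ℕ} (γ : (Σ l : Fin j, Fin (d l)) → ℤ) : Space d :=
  WithLp.toLp 2 fun i => (γ i : ℝ)

/-- The lattice `ℤⁿ ⊆ ℝⁿ`. -/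
def lattice (d : Fin j → ℕ) : Set (Space d) :=
  Set.range (latticePoint (d := d))

/-- `U = ∑ᵢ Tᵢ` in the sense of distributions: `U(φ) = ∑ᵢ Tᵢ(φ)`, with an (unconditionally)
convergent sum, for every test function `φ`. -/
def HasDistribSum {d : Fin j → ℕ} {ι : Type*}
    (T : ι → 𝓓'((⊤ : TopologicalSpace.Opens (Space d)), ℂ))
    (U : 𝓓'((⊤ : TopologicalSpace.Opens (Space d)), ℂ)) : Prop :=
  ∀ φ : 𝓓((⊤ : TopologicalSpace.Opens (Space d)), ℝ), HasSum (fun i => T i φ) (U φ)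

end AnisotropicSobolev

end

noncomputable section

namespace AnisotropicSobolev

variable {j : ℕ} {d : Fin j → ℕ}

/-! Everything rests on one estimate: for a fixed Schwartz function `χ` and every `s`, the pieces `χ
· φ(· + γ)`, with `γ` in the lattice, satisfy `∑ ‖χ φ(· + γ)‖²_s ≤ C ‖φ‖²_s`
(`sum_norm_sq_bracketDS_le`). On the Fourier side, the piece with index `γ` has at `ξ` the value `∫
𝓕χ(ξ - η) e^{2πi⟨γ, η⟩} 𝓕φ(η) dη`, a Fourier coefficient of a rapidly decaying function of `ξ - η`
times `𝓕φ`. A Bessel inequality, uniform in `ξ`, bounds the sum over `γ` by a weighted `L²` integral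
of `𝓕φ`. The symbol changes between `ξ` and `η` by at most a power of `1 + |ξ - η|²`, which the
decay of `𝓕χ` absorbs; integrating in `ξ` finishes the estimate.

The condition on `K - K` provides a cutoff `χ` equal to `1` near `K` whose support misses `K + γ`
for all `γ ≠ 0`. Thus `u_γ = χ · u(· + γ)`. The estimate at `s`, extended from Schwartz functions to
`L²` by density, then bounds `∑ ‖u_γ‖²` by `‖u‖²` (`exists_sum_norm_sq_le`). Conversely, `u_γ(φ(· +
γ)) = u_γ(χ φ(· + γ))`, so Cauchy–Schwarz and the estimate at `-s` bound `|u(φ)|` by `(∑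
‖u_γ‖²_s)^{1/2} ‖φ‖_{-s}`, and the Riesz representation theorem places `u` in `ℋ^s`
(`exists_hasSum_of_summable`). -/

/-! ### Orthogonality of the lattice characters on unit cubes -/

/-- The uniform probability measure on the unit cube. -/
def cubeMeasure (ι : Type*) [Fintype ι] : Measure (ι → ℝ) :=
  Measure.pi fun _ => volume.restrict (Set.Ioc 0 1)

instance (ι : Type*) [Fintype ι] : IsProbabilityMeasure (cubeMeasure ι) := by
  have : IsProbabilityMeasure ((volume : Measure ℝ).restrict (Set.Ioc 0 1)) := ⟨by simp⟩
  unfold cubeMeasure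
  infer_instance

theorem ae_cubeMeasure (ι : Type*) [Fintype ι] :
    ∀ᵐ t ∂cubeMeasure ι, ∀ i, t i ∈ Set.Ioc (0 : ℝ) 1 := by
  rw [cubeMeasure, ← Measure.restrict_pi_pi, ae_restrict_iff' (MeasurableSet.univ_pi fun _ =>
    measurableSet_Ioc)]
  exact Filter.Eventually.of_forall fun t ht i => ht i trivial

theorem integral_exp_two_pi_int (m : ℤ) :
    ∫ t in Set.Ioc (0 : ℝ) 1, Complex.exp (2 * Real.pi * Complex.I * m * t) =
      if m = 0 then 1 else 0 := by
  split_ifs with h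
  · simp [h]
  · rw [← intervalIntegral.integral_of_le zero_le_one, integral_exp_mul_complex]
    · have : Complex.exp (2 * Real.pi * Complex.I * m * (1 : ℝ)) = 1 :=
        Complex.exp_eq_one_iff.2 ⟨m, by push_cast; ring⟩
      rw [this]; simp
    · simp [h, Real.pi_ne_zero]

theorem integral_exp_cube {ι : Type*} [Fintype ι] (m : ι → ℤ) :
    ∫ t, Complex.exp (2 * Real.pi * Complex.I * ∑ i, (m i : ℂ) * (t i : ℂ)) ∂cubeMeasure ι =
      if m = 0 then 1 else 0 := by
  have h : ∀ t : ι → ℝ, Complex.exp (2 * Real.pi * Complex.I * ∑ i, (m i : ℂ) * (t i : ℂ)) =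
      ∏ i, Complex.exp (2 * Real.pi * Complex.I * m i * t i) := fun t => by
    rw [← Complex.exp_sum, Finset.mul_sum]; simp only [mul_assoc]
  simp_rw [h]
  rw [cubeMeasure, integral_fintype_prod_eq_prod
    (f := fun i (t : ℝ) => Complex.exp (2 * Real.pi * Complex.I * m i * t))]
  simp_rw [integral_exp_two_pi_int]
  split_ifs with h0
  · simp [h0]
  · obtain ⟨i, hi⟩ := Function.ne_iff.1 h0
    exact Finset.prod_eq_zero (Finset.mem_univ i) (if_neg hi)

/-- The character `y ↦ exp (2πi⟨γ, y⟩)` of `ℝⁿ` given by a lattice point `γ`. -/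
def latticeChar (γ : (Σ l : Fin j, Fin (d l)) → ℤ) (y : Space d) : ℂ :=
  Complex.exp (2 * Real.pi * Complex.I * ∑ i, (γ i : ℂ) * (y i : ℂ))

@[fun_prop]
theorem continuous_latticeChar (γ : (Σ l : Fin j, Fin (d l)) → ℤ) :
    Continuous (latticeChar γ : Space d → ℂ) := by
  unfold latticeChar; fun_prop

theorem norm_latticeChar (γ : (Σ l : Fin j, Fin (d l)) → ℤ) (y : Space d) :
    ‖latticeChar γ y‖ = 1 := by
  have : (2 * Real.pi * Complex.I * ∑ i, (γ i : ℂ) * (y i : ℂ) : ℂ) =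
      ((2 * Real.pi * ∑ i, (γ i : ℝ) * y i : ℝ) : ℂ) * Complex.I := by push_cast; ring
  rw [latticeChar, this, Complex.norm_exp_ofReal_mul_I]

theorem latticeChar_add (γ : (Σ l : Fin j, Fin (d l)) → ℤ) (x y : Space d) :
    latticeChar γ (x + y) = latticeChar γ x * latticeChar γ y := by
  simp only [latticeChar, ← Complex.exp_add, ← mul_add, ← Finset.sum_add_distrib, PiLp.add_apply,
    Complex.ofReal_add]

theorem conj_latticeChar (γ : (Σ l : Fin j, Fin (d l)) → ℤ) (y : Space d) :
    starRingEnd ℂ (latticeChar γ y) = latticeChar (-γ) y := by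
  have h2 : starRingEnd ℂ 2 = 2 := map_ofNat _ 2
  simp [latticeChar, ← Complex.exp_conj, h2]

theorem latticeChar_mul (γ γ' : (Σ l : Fin j, Fin (d l)) → ℤ) (y : Space d) :
    latticeChar γ y * latticeChar γ' y = latticeChar (γ + γ') y := by
  simp only [latticeChar, ← Complex.exp_add, ← mul_add, ← Finset.sum_add_distrib, Pi.add_apply,
    Int.cast_add, add_mul]

theorem integral_latticeChar_cube (γ : (Σ l : Fin j, Fin (d l)) → ℤ) (y : Space d) :
    ∫ t, latticeChar γ (y + WithLp.toLp 2 t) ∂cubeMeasure _ = if γ = 0 then 1 else 0 := by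
  simp_rw [latticeChar_add, integral_const_mul]
  have : ∫ t, latticeChar γ (WithLp.toLp 2 t) ∂cubeMeasure _ = if γ = 0 then 1 else 0 :=
    integral_exp_cube γ
  rw [this]
  split_ifs with h
  · simp [h, latticeChar]
  · simp

/-- Parseval on a translated cube: expanding `|P|²` as a double sum, orthogonality leaves only the
diagonal. The base point `y` is arbitrary because translation multiplies each character by a
constant of modulus one. -/
theorem lintegral_trigPolynomial_cube (F : Finset ((Σ l : Fin j, Fin (d l)) → ℤ))
    (c : ((Σ l : Fin j, Fin (d l)) → ℤ) → ℂ) (y : Space d) :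
    ∫⁻ t, ‖∑ γ ∈ F, c γ * latticeChar γ (y + WithLp.toLp 2 t)‖ₑ ^ 2 ∂cubeMeasure _ =
      ∑ γ ∈ F, ‖c γ‖ₑ ^ 2 := by
  set P : ((Σ l : Fin j, Fin (d l)) → ℝ) → ℂ :=
    fun t => ∑ γ ∈ F, c γ * latticeChar γ (y + WithLp.toLp 2 t) with hP
  have hPc : Continuous P := by fun_prop
  have hPb : ∀ t, ‖P t‖ ≤ ∑ γ ∈ F, ‖c γ‖ := fun t =>
    (norm_sum_le _ _).trans (by simp [norm_latticeChar])
  have hint : ∀ g : ((Σ l : Fin j, Fin (d l)) → ℝ) → ℂ, Continuous g → (∃ B, ∀ t, ‖g t‖ ≤ B) →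
      Integrable g (cubeMeasure _) := fun g hg ⟨B, hB⟩ =>
    Integrable.of_bound hg.aestronglyMeasurable B (Filter.Eventually.of_forall hB)
  have key : ∫ t, ((‖P t‖ ^ 2 : ℝ) : ℂ) ∂cubeMeasure _ = ((∑ γ ∈ F, ‖c γ‖ ^ 2 : ℝ) : ℂ) := by
    have h1 : ∀ t, ((‖P t‖ ^ 2 : ℝ) : ℂ) = ∑ γ ∈ F, ∑ γ' ∈ F,
        (c γ * starRingEnd ℂ (c γ')) * latticeChar (γ + -γ') (y + WithLp.toLp 2 t) := fun t => by
      rw [Complex.ofReal_pow, ← Complex.mul_conj', hP, map_sum, Finset.sum_mul_sum]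
      refine Finset.sum_congr rfl fun γ _ => Finset.sum_congr rfl fun γ' _ => ?_
      rw [map_mul, conj_latticeChar, ← latticeChar_mul]
      ring
    have h2 : ∀ γ γ', Integrable (fun t => (c γ * starRingEnd ℂ (c γ')) *
        latticeChar (γ + -γ') (y + WithLp.toLp 2 t)) (cubeMeasure _) := fun γ γ' =>
      hint _ (by fun_prop) ⟨‖c γ * starRingEnd ℂ (c γ')‖, fun t => by
        rw [norm_mul, norm_latticeChar, mul_one]⟩
    simp_rw [h1]
    rw [integral_finsetSum _ fun γ _ => integrable_finsetSum _ fun γ' _ => h2 γ γ',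
      Complex.ofReal_sum]
    refine Finset.sum_congr rfl fun γ hγ => ?_
    rw [integral_finsetSum _ fun γ' _ => h2 γ γ']
    simp_rw [integral_const_mul, integral_latticeChar_cube, add_neg_eq_zero]
    rw [Finset.sum_eq_single γ]
    · simp [Complex.mul_conj']
    · intro b _ hb
      simp [hb.symm]
    · exact fun h => (h hγ).elim
  have h3 : ∫ t, ‖P t‖ ^ 2 ∂cubeMeasure _ = ∑ γ ∈ F, ‖c γ‖ ^ 2 := by
    rw [integral_complex_ofReal] at key
    exact_mod_cast key
  have h4 : ∀ z : ℂ, ‖z‖ₑ ^ 2 = ENNReal.ofReal (‖z‖ ^ 2) := fun z => by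
    rw [ENNReal.ofReal_pow (norm_nonneg _), ofReal_norm]
  simp_rw [h4]
  rw [← ofReal_integral_eq_lintegral_ofReal, h3, ENNReal.ofReal_sum_of_nonneg]
  · intros; positivity
  · refine Integrable.of_bound (by fun_prop) ((∑ γ ∈ F, ‖c γ‖) ^ 2)
      (Filter.Eventually.of_forall fun t => ?_)
    rw [norm_pow, norm_norm]
    gcongr
    exact hPb t
  · exact Filter.Eventually.of_forall fun t => by positivity

/-! ### Decaying weights and a Bessel inequality -/

/-- The weight `(1 + ‖x‖²)^{-M}`. -/
def decayWeight (M : ℕ) (x : Space d) : ENNReal := ENNReal.ofReal (((1 + ‖x‖ ^ 2) ^ M)⁻¹)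

@[fun_prop]
theorem measurable_decayWeight (M : ℕ) : Measurable (decayWeight M : Space d → ENNReal) := by
  unfold decayWeight; fun_prop

theorem one_add_norm_sq_le {V : Type*} [SeminormedAddCommGroup V] (x y : V) :
    1 + ‖x‖ ^ 2 ≤ 2 * (1 + ‖x - y‖ ^ 2) * (1 + ‖y‖ ^ 2) := by
  have h : ‖x‖ ≤ ‖x - y‖ + ‖y‖ := by simpa using norm_add_le (x - y) y
  have h2 : ‖x‖ ^ 2 ≤ (‖x - y‖ + ‖y‖) ^ 2 := by gcongr
  nlinarith [sq_nonneg (‖x - y‖ - ‖y‖), mul_nonneg (sq_nonneg ‖x - y‖) (sq_nonneg ‖y‖)]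

theorem decayWeight_le (M : ℕ) {R : ℝ} (x t : Space d) (ht : ‖t‖ ^ 2 ≤ R) :
    decayWeight M x ≤ ENNReal.ofReal ((2 * (1 + R)) ^ M) * decayWeight M (x - t) := by
  have hR : 0 ≤ R := (sq_nonneg _).trans ht
  rw [decayWeight, decayWeight, ← ENNReal.ofReal_mul (by positivity)]
  refine ENNReal.ofReal_le_ofReal ?_
  rw [← div_eq_mul_inv, inv_eq_one_div, div_le_div_iff₀ (by positivity) (by positivity), one_mul,
    ← mul_pow]
  refine pow_le_pow_left₀ (by positivity) ?_ M
  have := one_add_norm_sq_le (x - t) x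
  rw [show x - t - x = -t by abel, norm_neg] at this
  refine this.trans ?_
  gcongr

theorem lintegral_decayWeight_lt_top {M : ℕ} (hM : Fintype.card (Σ l : Fin j, Fin (d l)) < M) :
    ∫⁻ x : Space d, decayWeight M x < ⊤ := by
  have h : Integrable (fun x : Space d => (1 + ‖x‖ ^ 2) ^ (-(2 * M : ℝ) / 2)) volume := by
    refine integrable_rpow_neg_one_add_norm_sq ?_
    rw [finrank_euclideanSpace]
    have : (Fintype.card (Σ l : Fin j, Fin (d l)) : ℝ) < M := by exact_mod_cast hM
    have : (0 : ℝ) ≤ M := by positivity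
    linarith
  have h2 := h.lintegral_lt_top
  convert h2 using 4 with x
  rw [neg_div, Real.rpow_neg (by positivity), mul_div_cancel_left₀ _ two_ne_zero, Real.rpow_natCast]
  rfl

/-- The `L²` norm of a trigonometric polynomial with respect to a decaying weight is bounded by the
`ℓ²` norm of its coefficients. -/
theorem lintegral_decayWeight_trigPolynomial_le {M : ℕ}
    (hM : Fintype.card (Σ l : Fin j, Fin (d l)) < M) :
    ∃ C : ENNReal, C ≠ ⊤ ∧ ∀ (ξ : Space d) (F : Finset ((Σ l : Fin j, Fin (d l)) → ℤ))
      (c : ((Σ l : Fin j, Fin (d l)) → ℤ) → ℂ),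
      ∫⁻ η, decayWeight M (ξ - η) * ‖∑ γ ∈ F, c γ * latticeChar γ η‖ₑ ^ 2 ≤
        C * ∑ γ ∈ F, ‖c γ‖ₑ ^ 2 := by
  set A : ENNReal := ENNReal.ofReal
    ((2 * (1 + (Fintype.card (Σ l : Fin j, Fin (d l)) : ℝ))) ^ M) with hA
  refine ⟨A * ∫⁻ x : Space d, decayWeight M x,
    ENNReal.mul_ne_top ENNReal.ofReal_ne_top (lintegral_decayWeight_lt_top hM).ne,
    fun ξ F c => ?_⟩
  set P : Space d → ℂ := fun η => ∑ γ ∈ F, c γ * latticeChar γ η with hP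
  have hPc : Continuous P := by fun_prop
  -- A shift by a point `t` of the unit cube has `‖t‖² ≤ n`, so it changes the weight by at most the
  -- factor `A`; hence the weight may be replaced by its average over the cube.
  have hpt : ∀ η, decayWeight M (ξ - η) * ‖P η‖ₑ ^ 2 ≤
      A * ∫⁻ t, decayWeight M (ξ - η + WithLp.toLp 2 t) * ‖P η‖ₑ ^ 2 ∂cubeMeasure _ := by
    intro η
    have h1 : decayWeight M (ξ - η) ≤
        A * ∫⁻ t, decayWeight M (ξ - η + WithLp.toLp 2 t) ∂cubeMeasure _ := by
      calc decayWeight M (ξ - η) = ∫⁻ _, decayWeight M (ξ - η) ∂cubeMeasure _ := by simp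
        _ ≤ ∫⁻ t, A * decayWeight M (ξ - η + WithLp.toLp 2 t) ∂cubeMeasure _ := by
          refine lintegral_mono_ae ?_
          filter_upwards [ae_cubeMeasure _] with t ht
          have := decayWeight_le (R := (Fintype.card (Σ l : Fin j, Fin (d l)) : ℝ)) M (ξ - η)
            (-WithLp.toLp 2 t) (by
              rw [norm_neg, EuclideanSpace.norm_sq_eq]
              calc _ ≤ ∑ i : (Σ l : Fin j, Fin (d l)), (1 : ℝ) := by
                    refine Finset.sum_le_sum fun i _ => ?_
                    rw [Real.norm_of_nonneg (ht i).1.le]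
                    exact pow_le_one₀ (ht i).1.le (ht i).2
                _ = _ := by simp)
          rwa [sub_neg_eq_add] at this
        _ = _ := lintegral_const_mul _ (by fun_prop)
    rw [lintegral_mul_const _ (by fun_prop), ← mul_assoc]
    gcongr
  calc ∫⁻ η, decayWeight M (ξ - η) * ‖P η‖ₑ ^ 2
      ≤ ∫⁻ η, A * ∫⁻ t, decayWeight M (ξ - η + WithLp.toLp 2 t) * ‖P η‖ₑ ^ 2 ∂cubeMeasure _ :=
        lintegral_mono hpt
    _ = A * ∫⁻ η, ∫⁻ t, decayWeight M (ξ - η + WithLp.toLp 2 t) * ‖P η‖ₑ ^ 2 ∂cubeMeasure _ :=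
        lintegral_const_mul' _ _ ENNReal.ofReal_ne_top
    _ = A * ∫⁻ t, ∫⁻ η, decayWeight M (ξ - η + WithLp.toLp 2 t) * ‖P η‖ₑ ^ 2 ∂volume
          ∂cubeMeasure _ := by
        rw [lintegral_lintegral_swap]
        refine Measurable.aemeasurable ?_
        unfold Function.uncurry
        fun_prop
    _ = A * ∫⁻ t, ∫⁻ η, decayWeight M (ξ - η) * ‖P (η + WithLp.toLp 2 t)‖ₑ ^ 2 ∂volume
          ∂cubeMeasure _ := by
        congr 1
        refine lintegral_congr fun t => ?_
        -- Substituting `η + t` for `η` moves the shift from the weight to `P`; the average over `t`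
        -- then becomes the Parseval integral.
        rw [← lintegral_add_right_eq_self _ (WithLp.toLp 2 t : Space d)]
        refine lintegral_congr fun η => ?_
        congr 2
        abel
    _ = A * ∫⁻ η, ∫⁻ t, decayWeight M (ξ - η) * ‖P (η + WithLp.toLp 2 t)‖ₑ ^ 2 ∂cubeMeasure _ := by
        rw [lintegral_lintegral_swap]
        refine Measurable.aemeasurable ?_
        unfold Function.uncurry
        fun_prop
    _ = A * ∫⁻ η, decayWeight M (ξ - η) * ∑ γ ∈ F, ‖c γ‖ₑ ^ 2 := by
        congr 1
        refine lintegral_congr fun η => ?_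
        rw [lintegral_const_mul _ (by fun_prop), lintegral_trigPolynomial_cube]
    _ = A * (∫⁻ x : Space d, decayWeight M x) * ∑ γ ∈ F, ‖c γ‖ₑ ^ 2 := by
        rw [lintegral_mul_const _ (by fun_prop), lintegral_sub_left_eq_self, mul_assoc]

/-- Cauchy–Schwarz for the weighted measure `w μ`, obtained by giving `w^{1/2}` to each factor. -/
theorem lintegral_mul_mul_le_sqrt {α : Type*} [MeasurableSpace α] (μ : Measure α)
    {w f g : α → ENNReal} (hw : AEMeasurable w μ) (hf : AEMeasurable f μ) (hg : AEMeasurable g μ) :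
    (∫⁻ a, w a * f a * g a ∂μ) ^ 2 ≤ (∫⁻ a, w a * f a ^ 2 ∂μ) * ∫⁻ a, w a * g a ^ 2 ∂μ := by
  have h := ENNReal.lintegral_mul_le_Lp_mul_Lq μ Real.HolderConjugate.two_two
    (f := fun a => w a ^ (1 / 2 : ℝ) * f a) (g := fun a => w a ^ (1 / 2 : ℝ) * g a)
    (by fun_prop) (by fun_prop)
  have hsq : ∀ x : ENNReal, x ^ (1 / 2 : ℝ) * x ^ (1 / 2 : ℝ) = x := fun x => by
    rw [← ENNReal.rpow_add_of_nonneg _ _ (by norm_num) (by norm_num)]; norm_num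
  have h1 : ∀ x y z : ENNReal, x ^ (1 / 2 : ℝ) * y * (x ^ (1 / 2 : ℝ) * z) = x * y * z :=
    fun x y z => by rw [mul_mul_mul_comm, hsq, mul_assoc]
  have h2 : ∀ x y : ENNReal, (x ^ (1 / 2 : ℝ) * y) ^ (2 : ℝ) = x * y ^ 2 := fun x y => by
    rw [ENNReal.rpow_two, mul_pow, sq (x ^ (1 / 2 : ℝ)), hsq]
  simp only [Pi.mul_apply, h1, h2] at h
  calc _ ≤ ((∫⁻ a, w a * f a ^ 2 ∂μ) ^ (1 / 2 : ℝ) * (∫⁻ a, w a * g a ^ 2 ∂μ) ^ (1 / 2 : ℝ)) ^ 2 := by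
        gcongr
    _ = _ := by rw [mul_pow, sq, sq, hsq, hsq]

/-- A Bessel inequality for the Fourier transform of a decaying function at the lattice points. -/
theorem sum_enorm_sq_integral_latticeChar_le {M : ℕ}
    (hM : Fintype.card (Σ l : Fin j, Fin (d l)) < M) :
    ∃ C : ENNReal, C ≠ ⊤ ∧ ∀ (ξ : Space d) (F : Finset ((Σ l : Fin j, Fin (d l)) → ℤ))
      (h : Space d → ℂ) (k : Space d → ENNReal), Integrable h → Measurable k →
      (∀ η, ‖h η‖ₑ ≤ decayWeight M (ξ - η) * k η) →
      ∑ γ ∈ F, ‖∫ η, h η * latticeChar γ η‖ₑ ^ 2 ≤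
        C * ∫⁻ η, decayWeight M (ξ - η) * k η ^ 2 := by
  obtain ⟨C, hC, hbound⟩ := lintegral_decayWeight_trigPolynomial_le hM
  refine ⟨C, hC, fun ξ F h k hh hk hhk => ?_⟩
  -- Duality: with conjugated coefficients, the sum `S` to be bounded equals `∫ h P` for `P = ∑ c γ
  -- · latticeChar γ`. Weighted Cauchy–Schwarz and the bound on `P` give `S² ≤ (…) S`, and one
  -- factor `S` cancels.
  set c : ((Σ l : Fin j, Fin (d l)) → ℤ) → ℂ := fun γ =>
    starRingEnd ℂ (∫ η, h η * latticeChar γ η) with hc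
  set S : ENNReal := ∑ γ ∈ F, ‖∫ η, h η * latticeChar γ η‖ₑ ^ 2 with hS
  have hcS : ∑ γ ∈ F, ‖c γ‖ₑ ^ 2 = S := by
    refine Finset.sum_congr rfl fun γ _ => ?_
    rw [hc, RCLike.enorm_conj]
  have hStop : S ≠ ⊤ := ENNReal.sum_ne_top.2 fun γ _ => ENNReal.pow_ne_top enorm_ne_top
  have hint : ∀ γ, Integrable fun η => h η * latticeChar γ η := fun γ =>
    hh.mul_bdd (c := 1) (continuous_latticeChar γ).aestronglyMeasurable
      (Filter.Eventually.of_forall fun η => (norm_latticeChar γ η).le)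
  have hSP : ‖∫ η, h η * ∑ γ ∈ F, c γ * latticeChar γ η‖ₑ = S := by
    have : ∫ η, h η * ∑ γ ∈ F, c γ * latticeChar γ η = ((∑ γ ∈ F, ‖c γ‖ ^ 2 : ℝ) : ℂ) := by
      simp_rw [Finset.mul_sum, mul_left_comm (h _)]
      rw [integral_finsetSum _ fun γ _ => (hint γ).const_mul (c γ), Complex.ofReal_sum]
      refine Finset.sum_congr rfl fun γ _ => ?_
      rw [integral_const_mul, Complex.ofReal_pow, ← Complex.mul_conj']
      simp [hc]
    rw [this, ← hcS, ← ofReal_norm, Complex.norm_real, Real.norm_of_nonneg (by positivity),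
      ENNReal.ofReal_sum_of_nonneg (fun _ _ => by positivity)]
    refine Finset.sum_congr rfl fun γ _ => ?_
    rw [ENNReal.ofReal_pow (norm_nonneg _), ofReal_norm]
  have h1 : S ≤ ∫⁻ η, decayWeight M (ξ - η) * k η * ‖∑ γ ∈ F, c γ * latticeChar γ η‖ₑ := by
    rw [← hSP]
    refine (enorm_integral_le_lintegral_enorm _).trans (lintegral_mono fun η => ?_)
    rw [enorm_mul]
    gcongr
    exact hhk η
  have h2 : S ^ 2 ≤ (C * ∫⁻ η, decayWeight M (ξ - η) * k η ^ 2) * S := by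
    calc S ^ 2 ≤ _ := pow_le_pow_left₀ zero_le h1 2
      _ ≤ _ := lintegral_mul_mul_le_sqrt _ (by fun_prop) (by fun_prop) (by fun_prop)
      _ ≤ _ := mul_le_mul_right (hbound ξ F c) _
      _ = _ := by rw [hcS]; ring
  by_cases h0 : S = 0
  · rw [h0]; exact zero_le
  · rw [sq] at h2
    exact (ENNReal.mul_le_mul_iff_left h0 hStop).1 h2

/-! ### The square-sum estimate for localized translates of Schwartz functions -/

section Estimate

open FourierTransform

theorem fourierInv_neg_apply (φ : 𝓢(Space d, ℂ)) (ξ : Space d) : 𝓕⁻ φ (-ξ) = 𝓕 φ ξ := by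
  rw [SchwartzMap.fourierInv_apply_eq]
  simp

theorem fourier_neg_apply (φ : 𝓢(Space d, ℂ)) (ξ : Space d) : 𝓕 φ (-ξ) = 𝓕⁻ φ ξ := by
  rw [← fourierInv_neg_apply, neg_neg]

/-- The Fourier transform turns products into convolutions. -/
theorem fourier_smulLeftCLM_apply (χ φ : 𝓢(Space d, ℂ)) (ξ : Space d) :
    𝓕 (SchwartzMap.smulLeftCLM ℂ χ φ) ξ = ∫ η, 𝓕 χ (ξ - η) * 𝓕 φ η := by
  -- The convolution theorem is applied to inverse transforms; reflecting `ξ` and `η` afterwards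
  -- turns `𝓕⁻` back into `𝓕`.
  have h : SchwartzMap.convolution (ContinuousLinearMap.mul ℂ ℂ) (𝓕⁻ φ) (𝓕⁻ χ) =
      𝓕⁻ (SchwartzMap.smulLeftCLM ℂ χ φ) := by
    have h1 : 𝓕 (SchwartzMap.convolution (ContinuousLinearMap.mul ℂ ℂ) (𝓕⁻ φ) (𝓕⁻ χ)) =
        SchwartzMap.smulLeftCLM ℂ χ φ := by
      rw [SchwartzMap.fourier_convolution]
      ext x
      simp [SchwartzMap.smulLeftCLM_apply_apply χ.hasTemperateGrowth, mul_comm]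
    rw [← h1, fourierInv_fourier_eq]
  rw [← fourierInv_neg_apply, ← h, SchwartzMap.convolution_apply, convolution,
    ← integral_neg_eq_self]
  refine integral_congr_ae (Filter.Eventually.of_forall fun η => ?_)
  simp only [ContinuousLinearMap.mul_apply']
  rw [show -ξ - -η = -(ξ - η) by abel, fourierInv_neg_apply, fourierInv_neg_apply, mul_comm]

theorem fourier_compSubConstCLM_latticePoint (γ : (Σ l : Fin j, Fin (d l)) → ℤ)
    (φ : 𝓢(Space d, ℂ)) (η : Space d) :
    𝓕 (φ.compSubConstCLM ℂ (-latticePoint γ)) η = latticeChar γ η * 𝓕 φ η := by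
  rw [SchwartzMap.fourier_coe, SchwartzMap.fourier_coe, Real.fourier_eq', Real.fourier_eq',
    ← integral_const_mul, ← integral_sub_right_eq_self _ (latticePoint γ)]
  refine integral_congr_ae (Filter.Eventually.of_forall fun x => ?_)
  have h : latticeChar γ η =
      Complex.exp ((2 * Real.pi * inner ℝ (latticePoint γ) η : ℝ) * Complex.I) := by
    rw [latticeChar, PiLp.inner_apply]
    congr 1
    push_cast
    simp only [latticePoint, RCLike.inner_apply, conj_trivial]
    push_cast
    simp_rw [mul_comm (Complex.ofReal (η.ofLp _))]
    ring
  simp only [smul_eq_mul, SchwartzMap.compSubConstCLM_apply, sub_neg_eq_add, sub_add_cancel]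
  rw [h, ← mul_assoc, ← Complex.exp_add, inner_sub_left]
  congr 2
  push_cast
  ring

theorem exists_enorm_le_decayWeight (f : 𝓢(Space d, ℂ)) (M : ℕ) :
    ∃ B : ENNReal, B ≠ ⊤ ∧ ∀ x, ‖f x‖ₑ ≤ B * decayWeight M x := by
  -- The exponent is doubled because `1 + ‖x‖² ≤ (1 + ‖x‖)²`.
  set S := 2 ^ (2 * M) * ((Finset.Iic (2 * M, 0)).sup
    fun m => SchwartzMap.seminorm ℝ m.1 m.2) f with hS
  have h : ∀ x, (1 + ‖x‖) ^ (2 * M) * ‖f x‖ ≤ S := fun x => by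
    have := SchwartzMap.one_add_le_sup_seminorm_apply (𝕜 := ℝ) (m := (2 * M, 0)) le_rfl le_rfl f x
    rwa [norm_iteratedFDeriv_zero] at this
  refine ⟨ENNReal.ofReal S, ENNReal.ofReal_ne_top, fun x => ?_⟩
  have hS0 : 0 ≤ S := le_trans (by positivity) (h x)
  rw [decayWeight, ← ENNReal.ofReal_mul hS0, ← ofReal_norm]
  refine ENNReal.ofReal_le_ofReal ?_
  rw [← div_eq_mul_inv, le_div_iff₀ (by positivity), mul_comm]
  refine le_trans ?_ (h x)
  rw [pow_mul]
  gcongr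
  nlinarith [norm_nonneg x]

/-- Localized translates of a Schwartz function are square summable with respect to a weighted
`L²` norm of the Fourier transform, if the weight is slowly varying. -/
theorem sum_lintegral_weight_fourier_le (χ : 𝓢(Space d, ℂ)) {b : Space d → ENNReal}
    (hb : Measurable b) {A : ENNReal} (hA : A ≠ ⊤) (N : ℕ)
    (hbA : ∀ ξ η, b ξ * decayWeight N (ξ - η) ≤ A * b η) :
    ∃ C : ENNReal, C ≠ ⊤ ∧ ∀ (φ : 𝓢(Space d, ℂ)) (F : Finset ((Σ l : Fin j, Fin (d l)) → ℤ)),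
      ∑ γ ∈ F, ∫⁻ ξ, b ξ *
        ‖𝓕 (SchwartzMap.smulLeftCLM ℂ χ (φ.compSubConstCLM ℂ (-latticePoint γ))) ξ‖ₑ ^ 2 ≤
      C * ∫⁻ ξ, b ξ * ‖𝓕 φ ξ‖ₑ ^ 2 := by
  set M := Fintype.card (Σ l : Fin j, Fin (d l)) + 1 with hM
  obtain ⟨C, hC, hbessel⟩ := sum_enorm_sq_integral_latticeChar_le (d := d) (M := N + M) (by omega)
  obtain ⟨B, hB, hχ⟩ := exists_enorm_le_decayWeight (𝓕 χ) (N + M)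
  set I := ∫⁻ x : Space d, decayWeight M x with hI
  have hI' : I ≠ ⊤ := (lintegral_decayWeight_lt_top (by omega)).ne
  -- The decay of `𝓕 χ` is spent twice: `N` powers carry the weight `b` from `ξ` to `η`, and the
  -- remaining `M > n` powers make the integral over `ξ` finite.
  have hsplit : ∀ x : Space d, decayWeight (N + M) x = decayWeight N x * decayWeight M x :=
    fun x => by
      rw [decayWeight, decayWeight, decayWeight, ← ENNReal.ofReal_mul (by positivity), pow_add,
        mul_inv]
  refine ⟨C * B ^ 2 * A * I, by finiteness, fun φ F => ?_⟩
  have hpt : ∀ ξ, ∑ γ ∈ F,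
      ‖𝓕 (SchwartzMap.smulLeftCLM ℂ χ (φ.compSubConstCLM ℂ (-latticePoint γ))) ξ‖ₑ ^ 2 ≤
      C * ∫⁻ η, decayWeight (N + M) (ξ - η) * (B * ‖𝓕 φ η‖ₑ) ^ 2 := fun ξ => by
    have hint : Integrable fun η => 𝓕 χ (ξ - η) * 𝓕 φ η := by
      refine (𝓕 φ).integrable.bdd_mul (c := SchwartzMap.seminorm ℝ 0 0 (𝓕 χ)) ?_
        (Filter.Eventually.of_forall fun η => SchwartzMap.norm_le_seminorm ℝ _ _)
      exact ((𝓕 χ).continuous.comp (by fun_prop)).aestronglyMeasurable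
    have := hbessel ξ F (fun η => 𝓕 χ (ξ - η) * 𝓕 φ η) (fun η => B * ‖𝓕 φ η‖ₑ) hint
      (by have := (𝓕 φ).continuous.measurable; fun_prop) (fun η => by
        rw [enorm_mul, mul_left_comm, ← mul_assoc]
        gcongr
        exact hχ _)
    refine le_of_eq_of_le (Finset.sum_congr rfl fun γ _ => ?_) this
    rw [fourier_smulLeftCLM_apply]
    simp_rw [fourier_compSubConstCLM_latticePoint]
    congr 3
    ext η
    ring
  have hφm : Measurable fun η => ‖𝓕 φ η‖ₑ := by
    have := (𝓕 φ).continuous.measurable; fun_prop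
  calc _ = ∫⁻ ξ, b ξ * ∑ γ ∈ F,
      ‖𝓕 (SchwartzMap.smulLeftCLM ℂ χ (φ.compSubConstCLM ℂ (-latticePoint γ))) ξ‖ₑ ^ 2 := by
        simp_rw [Finset.mul_sum]
        rw [lintegral_finsetSum]
        intro γ _
        have := (𝓕 (SchwartzMap.smulLeftCLM ℂ χ
          (φ.compSubConstCLM ℂ (-latticePoint γ)))).continuous.measurable
        fun_prop
    _ ≤ ∫⁻ ξ, b ξ * (C * ∫⁻ η, decayWeight (N + M) (ξ - η) * (B * ‖𝓕 φ η‖ₑ) ^ 2) := by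
        gcongr with ξ
        exact hpt ξ
    _ = ∫⁻ ξ, C * ∫⁻ η, b ξ * decayWeight (N + M) (ξ - η) * (B * ‖𝓕 φ η‖ₑ) ^ 2 := by
        refine lintegral_congr fun ξ => ?_
        rw [mul_left_comm, ← lintegral_const_mul _ (by fun_prop)]
        simp_rw [mul_assoc]
    _ ≤ ∫⁻ ξ, C * ∫⁻ η, A * b η * decayWeight M (ξ - η) * (B * ‖𝓕 φ η‖ₑ) ^ 2 := by
        refine lintegral_mono fun ξ => mul_le_mul_right (lintegral_mono fun η => ?_) C
        rw [hsplit, ← mul_assoc]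
        exact mul_le_mul_left (mul_le_mul_left (hbA ξ η) _) _
    _ = C * ∫⁻ η, ∫⁻ ξ, A * b η * decayWeight M (ξ - η) * (B * ‖𝓕 φ η‖ₑ) ^ 2 := by
        rw [lintegral_const_mul' _ _ hC, lintegral_lintegral_swap]
        have h1 : Measurable fun p : Space d × Space d => A * b p.2 * decayWeight M (p.1 - p.2) := by
          fun_prop
        exact (h1.mul (((hφm.comp measurable_snd).const_mul B).pow_const 2)).aemeasurable
    _ = C * ∫⁻ η, (B ^ 2 * A * I) * (b η * ‖𝓕 φ η‖ₑ ^ 2) := by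
        congr 1
        refine lintegral_congr fun η => ?_
        rw [lintegral_mul_const _ (by fun_prop), lintegral_const_mul _ (by fun_prop),
          lintegral_sub_right_eq_self, ← hI, mul_pow]
        ring
    _ = _ := by
        rw [lintegral_const_mul _ (by fun_prop)]
        ring

/-! ### The anisotropic symbol and its slow variation -/

/-- The symbol `ξ ↦ ⟨⟨2πξ⟩⟩^s` of `⟨⟨D⟩⟩^s`. -/
def symbol (d : Fin j → ℕ) (s : Fin j → ℝ) (ξ : Space d) : ℂ :=
  ((bracket d s ((2 * Real.pi) • ξ) : ℝ) : ℂ)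

theorem symbol_temperate (s : Fin j → ℝ) : (symbol d s).HasTemperateGrowth :=
  symbol_hasTemperateGrowth d s

theorem bracket_pos (s : Fin j → ℝ) (ξ : Space d) : 0 < bracket d s ξ :=
  Finset.prod_pos fun _ _ => by positivity

theorem symbol_mul_symbol_neg (s : Fin j → ℝ) : symbol d s * symbol d (-s) = fun _ => 1 := by
  ext ξ
  simp only [Pi.mul_apply, symbol, ← Complex.ofReal_mul, bracket, ← Finset.prod_mul_distrib,
    Pi.neg_apply]
  rw [Finset.prod_eq_one, Complex.ofReal_one]
  intro l _
  rw [← Real.rpow_add (by positivity)]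
  simp [neg_div]

theorem symbol_neg (s : Fin j → ℝ) (ξ : Space d) : symbol d s (-ξ) = symbol d s ξ := by
  simp [symbol, bracket]

theorem norm_block_le (l : Fin j) (x : Space d) : ‖block d l x‖ ≤ ‖x‖ := by
  rw [EuclideanSpace.norm_eq, EuclideanSpace.norm_eq]
  refine Real.sqrt_le_sqrt ?_
  rw [Fintype.sum_sigma]
  exact Finset.single_le_sum (f := fun l => ∑ i : Fin (d l), ‖x ⟨l, i⟩‖ ^ 2)
    (fun _ _ => by positivity) (Finset.mem_univ l)

/-- A Peetre type inequality for `⟨⟨ξ⟩⟩^s`. -/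
theorem exists_bracket_le (d : Fin j → ℕ) (s : Fin j → ℝ) :
    ∃ (A : ℝ) (N : ℕ), 0 ≤ A ∧ ∀ ξ η : Space d,
      bracket d s ξ ≤ A * (1 + ‖ξ - η‖ ^ 2) ^ N * bracket d s η := by
  obtain ⟨p, hp⟩ : ∃ p : ℕ, ∀ l, |s l / 2| ≤ p := by
    obtain ⟨p, hp⟩ := exists_nat_ge (∑ l, |s l / 2|)
    exact ⟨p, fun l => (Finset.single_le_sum (f := fun l => |s l / 2|) (fun _ _ => abs_nonneg _)
      (Finset.mem_univ l)).trans hp⟩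
  refine ⟨(2 ^ p) ^ j, p * j, by positivity, fun ξ η => ?_⟩
  -- For a single block: both comparisons between `x` and `y` are needed, since the sign of `q`
  -- decides which one is used. Each of the `j` blocks costs `(2(1 + ‖ξ - η‖²))^p`, whence the
  -- constants above.
  have key : ∀ x y z : ℝ, ∀ q : ℝ, 1 ≤ x → 1 ≤ y → 1 ≤ z → x ≤ z * y → y ≤ z * x → |q| ≤ p →
      x ^ q ≤ z ^ p * y ^ q := by
    intro x y z q hx hy hz hxy hyx hq
    have h1 : z ^ |q| ≤ z ^ p := by
      rw [← Real.rpow_natCast]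
      exact Real.rpow_le_rpow_of_exponent_le hz hq
    suffices x ^ q ≤ z ^ |q| * y ^ q from
      this.trans (mul_le_mul_of_nonneg_right h1 (by positivity))
    rcases le_total 0 q with h0 | h0
    · rw [abs_of_nonneg h0, ← Real.mul_rpow (by positivity) (by positivity)]
      exact Real.rpow_le_rpow (by positivity) hxy h0
    · rw [abs_of_nonpos h0, Real.rpow_neg (by positivity)]
      rw [← div_eq_inv_mul, le_div_iff₀ (by positivity), ← Real.mul_rpow (by positivity)
        (by positivity), mul_comm x]
      exact Real.rpow_le_rpow_of_nonpos (by positivity) hyx h0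
  calc bracket d s ξ
      ≤ ∏ l, ((2 * (1 + ‖ξ - η‖ ^ 2)) ^ p * (1 + ‖block d l η‖ ^ 2) ^ (s l / 2)) := by
        refine Finset.prod_le_prod (fun _ _ => by positivity) fun l _ => ?_
        have hle : ‖block d l ξ - block d l η‖ ^ 2 ≤ ‖ξ - η‖ ^ 2 := by
          rw [← map_sub]; gcongr; exact norm_block_le l _
        refine key _ _ _ _ ?_ ?_ ?_ ?_ ?_ (hp l)
        · nlinarith [sq_nonneg ‖block d l ξ‖]
        · nlinarith [sq_nonneg ‖block d l η‖]
        · nlinarith [sq_nonneg ‖ξ - η‖]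
        · refine (one_add_norm_sq_le _ (block d l η)).trans ?_
          gcongr
        · refine (one_add_norm_sq_le _ (block d l ξ)).trans ?_
          rw [norm_sub_rev (block d l η)]
          gcongr
    _ = _ := by
        rw [Finset.prod_mul_distrib, Finset.prod_const, Finset.card_univ, Fintype.card_fin, mul_pow,
          mul_pow, pow_mul]
        rfl

/-- `⟨⟨D⟩⟩^s` on Schwartz functions. -/
def bracketDS (d : Fin j → ℕ) (s : Fin j → ℝ) : 𝓢(Space d, ℂ) →L[ℂ] 𝓢(Space d, ℂ) :=
  SchwartzMap.fourierMultiplierCLM ℂ (symbol d s)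

theorem fourier_bracketDS (s : Fin j → ℝ) (φ : 𝓢(Space d, ℂ)) (ξ : Space d) :
    𝓕 (bracketDS d s φ) ξ = symbol d s ξ * 𝓕 φ ξ := by
  rw [bracketDS, SchwartzMap.fourierMultiplierCLM_apply, fourier_fourierInv_eq,
    SchwartzMap.smulLeftCLM_apply_apply (symbol_temperate s), smul_eq_mul]

/-- Plancherel turns the `ℋ^s` norm into the weighted Fourier integral of the preceding estimate. -/
theorem enorm_toLp_bracketDS_sq (s : Fin j → ℝ) (φ : 𝓢(Space d, ℂ)) :
    ‖(bracketDS d s φ).toLp 2‖ₑ ^ 2 = ∫⁻ ξ, ‖symbol d s ξ‖ₑ ^ 2 * ‖𝓕 φ ξ‖ₑ ^ 2 := by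
  have h1 : ‖(bracketDS d s φ).toLp 2‖ₑ = ‖(𝓕 (bracketDS d s φ)).toLp 2‖ₑ := by
    rw [← ofReal_norm, ← ofReal_norm, SchwartzMap.norm_fourier_toL2_eq]
  rw [h1, Lp.enorm_def, eLpNorm_congr_ae (SchwartzMap.coeFn_toLp _ _ _),
    eLpNorm_eq_lintegral_rpow_enorm_toReal two_ne_zero ENNReal.ofNat_ne_top]
  rw [← ENNReal.rpow_two, ← ENNReal.rpow_mul]
  simp only [ENNReal.toReal_ofNat, one_div, inv_mul_cancel₀ (two_ne_zero' ℝ), ENNReal.rpow_one,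
    ENNReal.rpow_two]
  refine lintegral_congr fun ξ => ?_
  rw [fourier_bracketDS, enorm_mul, mul_pow]

/-- Localized translates of a Schwartz function are square summable in `ℋ^s`. -/
theorem sum_norm_sq_bracketDS_le (s : Fin j → ℝ) (χ : 𝓢(Space d, ℂ)) :
    ∃ C : ℝ, 0 ≤ C ∧ ∀ (φ : 𝓢(Space d, ℂ)) (F : Finset ((Σ l : Fin j, Fin (d l)) → ℤ)),
      ∑ γ ∈ F, ‖(bracketDS d s (SchwartzMap.smulLeftCLM ℂ χ
        (φ.compSubConstCLM ℂ (-latticePoint γ)))).toLp 2‖ ^ 2 ≤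
      C * ‖(bracketDS d s φ).toLp 2‖ ^ 2 := by
  obtain ⟨A, N, hA, hAN⟩ := exists_bracket_le d s
  obtain ⟨C, hC, h⟩ := sum_lintegral_weight_fourier_le χ
    (b := fun ξ => ‖symbol d s ξ‖ₑ ^ 2)
    (by have := (symbol_temperate (d := d) s).1.continuous.measurable; fun_prop)
    -- The factor `(2π)²` comes from `1 + ‖2πx‖² ≤ (2π)² (1 + ‖x‖²)`; the outer square and the
    -- exponent `2 * N` come from squaring the symbol.
    (A := ENNReal.ofReal ((A * ((2 * Real.pi) ^ 2) ^ N) ^ 2)) ENNReal.ofReal_ne_top (2 * N)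
    (fun ξ η => by
      have hn : ∀ ξ : Space d, ‖symbol d s ξ‖ₑ ^ 2 =
          ENNReal.ofReal (bracket d s ((2 * Real.pi) • ξ) ^ 2) := fun ξ => by
        rw [symbol, ← ofReal_norm, Complex.norm_real, Real.norm_of_nonneg (bracket_pos _ _).le,
          ENNReal.ofReal_pow (bracket_pos _ _).le]
      rw [hn, hn, decayWeight, ← ENNReal.ofReal_mul (by positivity),
        ← ENNReal.ofReal_mul (by positivity)]
      refine ENNReal.ofReal_le_ofReal ?_
      rw [← div_eq_mul_inv, div_le_iff₀ (by positivity), mul_comm 2 N, pow_mul, ← mul_pow,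
        ← mul_pow]
      refine pow_le_pow_left₀ (bracket_pos _ _).le ((hAN _ ((2 * Real.pi) • η)).trans ?_) 2
      have h0 := (bracket_pos s ((2 * Real.pi) • η)).le
      rw [← smul_sub, norm_smul, Real.norm_of_nonneg (by positivity)]
      calc _ ≤ A * ((2 * Real.pi) ^ 2 * (1 + ‖ξ - η‖ ^ 2)) ^ N *
            bracket d s ((2 * Real.pi) • η) := by
            gcongr
            have : 1 ≤ (2 * Real.pi) ^ 2 := by nlinarith [Real.pi_gt_three]
            nlinarith [sq_nonneg ‖ξ - η‖]
        _ = _ := by rw [mul_pow]; ring)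
  refine ⟨C.toReal, ENNReal.toReal_nonneg, fun φ F => ?_⟩
  have h' := h φ F
  simp_rw [← enorm_toLp_bracketDS_sq] at h'
  have hc : ∀ x : Lp ℂ 2 (volume : Measure (Space d)), ‖x‖ₑ ^ 2 = ENNReal.ofReal (‖x‖ ^ 2) :=
    fun x => by rw [ENNReal.ofReal_pow (norm_nonneg _), ofReal_norm]
  simp_rw [hc] at h'
  rw [← ENNReal.ofReal_sum_of_nonneg (fun _ _ => by positivity), ← ENNReal.ofReal_toReal hC,
    ← ENNReal.ofReal_mul ENNReal.toReal_nonneg] at h'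
  exact (ENNReal.ofReal_le_ofReal_iff (by positivity)).1 h'

end Estimate

/-! ### Cutoffs, and supports of tempered distributions -/

section Cutoff

theorem hasTemperateGrowth_comp_smul {E : Type*} [NormedAddCommGroup E] [NormedSpace ℝ E]
    (χ : 𝓢(E, ℂ)) (a : ℝ) : (fun x => χ (a • x)).HasTemperateGrowth :=
  Function.HasTemperateGrowth.comp (g := χ) χ.hasTemperateGrowth
    (a • ContinuousLinearMap.id ℝ E).hasTemperateGrowth

variable {E : Type*} [NormedAddCommGroup E] [InnerProductSpace ℝ E]

open scoped Manifold ContDiff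
open Filter Topology

/-- Cutting off a Schwartz function at larger and larger radii approximates it. -/
theorem tendsto_smulLeftCLM_cutoff {χ : 𝓢(E, ℂ)} (hχ : ∀ x, ‖x‖ ≤ 1 → ∀ᶠ y in 𝓝 x, χ y = 1)
    (ψ : 𝓢(E, ℂ)) :
    Tendsto (fun n : ℕ => SchwartzMap.smulLeftCLM ℂ (fun x => χ ((n + 1 : ℝ)⁻¹ • x)) ψ) atTop
      (𝓝 ψ) := by
  rw [(schwartz_withSeminorms ℝ E ℂ).tendsto_nhds]
  rintro ⟨k, m⟩ ε hε
  set S := (∑ i ∈ Finset.range (m + 1), (m.choose i : ℝ) * SchwartzMap.seminorm ℝ 0 i χ *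
    SchwartzMap.seminorm ℝ (k + 1) (m - i) ψ) + SchwartzMap.seminorm ℝ (k + 1) m ψ with hS
  have hS0 : 0 ≤ S := by positivity
  -- The difference vanishes near each point with `‖x‖ ≤ n + 1`. Elsewhere the seminorms of order `k
  -- + 1` supply an additional factor `‖x‖ > n + 1`, while the derivatives of the dilated cutoff
  -- stay bounded because the dilation factor is at most `1`.
  have hbound : ∀ n : ℕ, SchwartzMap.seminorm ℝ k m
      (SchwartzMap.smulLeftCLM ℂ (fun x => χ ((n + 1 : ℝ)⁻¹ • x)) ψ - ψ) ≤ S / (n + 1) := by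
    intro n
    have hn : (0 : ℝ) < n + 1 := by positivity
    set a : ℝ := (n + 1 : ℝ)⁻¹ with ha
    have ha1 : |a| ≤ 1 := by
      rw [abs_of_nonneg (by positivity)]
      exact inv_le_one_of_one_le₀ (by linarith [(Nat.cast_nonneg n : (0 : ℝ) ≤ n)])
    have happ : ∀ x, SchwartzMap.smulLeftCLM ℂ (fun x => χ (a • x)) ψ x = χ (a • x) * ψ x :=
      fun x => SchwartzMap.smulLeftCLM_apply_apply (hasTemperateGrowth_comp_smul χ a) ψ x
    refine SchwartzMap.seminorm_le_bound ℝ k m _ (by positivity) fun x => ?_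
    by_cases hx : ‖x‖ ≤ n + 1
    · have h1 : ∀ᶠ y in 𝓝 x, χ (a • y) = 1 := by
        have : Tendsto (fun y : E => a • y) (𝓝 x) (𝓝 (a • x)) := by
          exact (continuous_const_smul a).tendsto x
        refine this.eventually (hχ (a • x) ?_)
        rw [norm_smul, Real.norm_of_nonneg (by positivity), ha, inv_mul_le_iff₀ hn, mul_one]
        exact hx
      have h2 : ((SchwartzMap.smulLeftCLM ℂ (fun x => χ (a • x)) ψ - ψ : 𝓢(E, ℂ)) : E → ℂ) =ᶠ[𝓝 x]
          fun _ => (0 : ℂ) := by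
        filter_upwards [h1] with y hy
        rw [sub_apply, happ, hy, one_mul, sub_self]
      rw [(Filter.EventuallyEq.iteratedFDeriv ℝ h2 m).eq_of_nhds, iteratedFDeriv_fun_zero]
      simp only [Pi.zero_apply, norm_zero, mul_zero]
      positivity
    · push Not at hx
      have hsm : ContDiff ℝ m (fun x => χ (a • x)) :=
        (χ.smooth m).comp (contDiff_const_smul a)
      have hD : ‖iteratedFDeriv ℝ m
          (SchwartzMap.smulLeftCLM ℂ (fun x => χ (a • x)) ψ - ψ : 𝓢(E, ℂ)) x‖ ≤
          (∑ i ∈ Finset.range (m + 1), (m.choose i : ℝ) * SchwartzMap.seminorm ℝ 0 i χ *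
            ‖iteratedFDeriv ℝ (m - i) ψ x‖) + ‖iteratedFDeriv ℝ m ψ x‖ := by
        have hfun : ((SchwartzMap.smulLeftCLM ℂ (fun x => χ (a • x)) ψ - ψ : 𝓢(E, ℂ)) : E → ℂ) =
            (fun x => χ (a • x) * ψ x) - ψ := by
          ext y
          rw [sub_apply, happ, Pi.sub_apply]
        rw [hfun, iteratedFDeriv_sub (hsm.mul (ψ.smooth m)) (ψ.smooth m)]
        refine (norm_sub_le _ _).trans (add_le_add_left ?_ _)
        refine (norm_iteratedFDeriv_mul_le hsm (ψ.smooth m) x le_rfl).trans ?_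
        refine Finset.sum_le_sum fun i _ => ?_
        gcongr
        rw [iteratedFDeriv_comp_const_smul a (χ.smooth i), norm_smul, norm_pow, Real.norm_eq_abs]
        calc _ ≤ 1 * SchwartzMap.seminorm ℝ 0 i χ := by
              gcongr
              · exact pow_le_one₀ (abs_nonneg a) ha1
              · exact SchwartzMap.norm_iteratedFDeriv_le_seminorm ℝ χ i _
          _ = _ := one_mul _
      have hmul : ∀ i, (n + 1) * ‖x‖ ^ k * ‖iteratedFDeriv ℝ i ψ x‖ ≤
          SchwartzMap.seminorm ℝ (k + 1) i ψ := fun i => by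
        refine le_trans ?_ (SchwartzMap.le_seminorm ℝ (k + 1) i ψ x)
        rw [pow_succ']
        gcongr
      rw [le_div_iff₀ hn, mul_comm, ← mul_assoc]
      calc _ ≤ (n + 1) * ‖x‖ ^ k * ((∑ i ∈ Finset.range (m + 1), (m.choose i : ℝ) *
            SchwartzMap.seminorm ℝ 0 i χ * ‖iteratedFDeriv ℝ (m - i) ψ x‖) +
            ‖iteratedFDeriv ℝ m ψ x‖) := by gcongr
        _ = (∑ i ∈ Finset.range (m + 1), (m.choose i : ℝ) *
            SchwartzMap.seminorm ℝ 0 i χ * ((n + 1) * ‖x‖ ^ k * ‖iteratedFDeriv ℝ (m - i) ψ x‖)) +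
            (n + 1) * ‖x‖ ^ k * ‖iteratedFDeriv ℝ m ψ x‖ := by
          rw [mul_add, Finset.mul_sum]
          congr 1
          exact Finset.sum_congr rfl fun i _ => by ring
        _ ≤ S := by
          rw [hS]
          gcongr
          · exact hmul _
          · exact hmul _
  have hlim : Tendsto (fun n : ℕ => S / ((n : ℝ) + 1)) atTop (𝓝 0) := by
    simpa [div_eq_mul_inv] using (tendsto_one_div_add_atTop_nhds_zero_nat (𝕜 := ℝ)).const_mul S
  filter_upwards [hlim.eventually (gt_mem_nhds hε)] with n hn
  exact (hbound n).trans_lt hn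

variable [FiniteDimensional ℝ E]

theorem exists_schwartz_bump {K V : Set E} (hK : IsCompact K) (hV : IsOpen V) (hKV : K ⊆ V) :
    ∃ χ : 𝓢(E, ℂ), HasCompactSupport χ ∧ tsupport χ ⊆ V ∧ ∀ x ∈ K, ∀ᶠ y in 𝓝 x, χ y = 1 := by
  obtain ⟨L, hL, hKL, hLV⟩ := exists_compact_between hK hV hKV
  obtain ⟨f, hf1, hf0, -⟩ := exists_contMDiffMap_one_nhds_of_subset_interior (n := ⊤) 𝓘(ℝ, E)
    hK.isClosed hKL
  have hsub : tsupport (fun x => (f x : ℂ)) ⊆ L := by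
    refine closure_minimal (fun x hx => ?_) hL.isClosed
    by_contra hxL
    exact hx (by simp [hf0 x hxL])
  have hcs : HasCompactSupport (fun x => (f x : ℂ)) :=
    hL.of_isClosed_subset (isClosed_tsupport _) hsub
  have hsm : ContDiff ℝ ∞ (fun x => (f x : ℂ)) :=
    Complex.ofRealCLM.contDiff.comp f.contMDiff.contDiff
  refine ⟨hcs.toSchwartzMap hsm, hcs, hsub.trans hLV, fun x hx => ?_⟩
  filter_upwards [eventually_nhdsSet_iff_forall.1 hf1 x hx] with y hy
  change (f y : ℂ) = 1
  simp [hy]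

/-- Compactly supported Schwartz functions are dense. -/
theorem exists_seq_hasCompactSupport_tendsto (ψ : 𝓢(E, ℂ)) :
    ∃ g : ℕ → 𝓢(E, ℂ), (∀ n, HasCompactSupport (g n)) ∧ (∀ n, tsupport (g n) ⊆ tsupport ψ) ∧
      Tendsto g atTop (𝓝 ψ) := by
  obtain ⟨χ, hχc, -, hχ1⟩ := exists_schwartz_bump (isCompact_closedBall (0 : E) 1) isOpen_univ
    (Set.subset_univ _)
  refine ⟨fun n => SchwartzMap.smulLeftCLM ℂ (fun x => χ ((n + 1 : ℝ)⁻¹ • x)) ψ, fun n => ?_,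
    fun n => ?_, tendsto_smulLeftCLM_cutoff (fun x hx => hχ1 x (by simpa using hx)) ψ⟩
  · rw [SchwartzMap.smulLeftCLM_apply (hasTemperateGrowth_comp_smul χ _)]
    exact (hχc.comp_smul (inv_ne_zero (by positivity : (n + 1 : ℝ) ≠ 0))).smul_right
  · exact (SchwartzMap.tsupport_smulLeftCLM_subset _ _).trans Set.inter_subset_left

theorem exists_smooth_partition {ι : Type*} [Fintype ι] {S : Set E} (hS : IsClosed S)
    {U : ι → Set E} (hU : ∀ i, IsOpen (U i)) (hSU : S ⊆ ⋃ i, U i) :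
    ∃ ρ : ι → E → ℝ, (∀ i, ContDiff ℝ ∞ (ρ i)) ∧ (∀ i, tsupport (ρ i) ⊆ U i) ∧
      ∀ x ∈ S, ∑ i, ρ i x = 1 := by
  obtain ⟨f, hf⟩ := SmoothPartitionOfUnity.exists_isSubordinate 𝓘(ℝ, E) hS U hU hSU
  refine ⟨fun i => f i, fun i => (f i).contMDiff.contDiff, hf, fun x hx => ?_⟩
  rw [← finsum_eq_sum_of_fintype, f.sum_eq_one hx]

/-- A partition of unity subordinate to the `U i` splits `ψ` into pieces, each killed by `T`. -/
theorem apply_eq_zero_of_tsupport_subset_iUnion {ι : Type*} [Fintype ι] {T : 𝓢'(E, ℂ)}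
    {ψ : 𝓢(E, ℂ)} (hψ : HasCompactSupport ψ) {U : ι → Set E} (hU : ∀ i, IsOpen (U i))
    (hT : ∀ i, Distribution.IsVanishingOn T (U i)) (hψU : tsupport ψ ⊆ ⋃ i, U i) : T ψ = 0 := by
  obtain ⟨ρ, hρ, hρU, hρ1⟩ := exists_smooth_partition (isClosed_tsupport ψ) hU hψU
  have hcs : ∀ i, HasCompactSupport fun x => (ρ i x : ℂ) * ψ x := fun i => hψ.mul_left
  have hsm : ∀ i, ContDiff ℝ ∞ fun x => (ρ i x : ℂ) * ψ x := fun i =>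
    (Complex.ofRealCLM.contDiff.comp (hρ i)).mul (ψ.smooth ⊤)
  have hsum : ψ = ∑ i, (hcs i).toSchwartzMap (hsm i) := by
    ext x
    rw [sum_apply]
    change ψ x = ∑ i, (ρ i x : ℂ) * ψ x
    rw [← Finset.sum_mul, ← Complex.ofReal_sum]
    by_cases hx : x ∈ tsupport ψ
    · rw [hρ1 x hx, Complex.ofReal_one, one_mul]
    · rw [image_eq_zero_of_notMem_tsupport hx, mul_zero]
  rw [hsum, map_sum]
  refine Finset.sum_eq_zero fun i _ => hT i _ ?_
  refine subset_trans (closure_mono fun x hx => ?_) (hρU i)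
  rw [Function.mem_support] at hx ⊢
  intro h0
  apply hx
  change (ρ i x : ℂ) * ψ x = 0
  rw [h0, Complex.ofReal_zero, zero_mul]

theorem apply_eq_zero_of_hasCompactSupport {T : 𝓢'(E, ℂ)} {ψ : 𝓢(E, ℂ)}
    (hψ : HasCompactSupport ψ) (h : Disjoint (tsupport ψ) (Distribution.dsupport T)) :
    T ψ = 0 := by
  have hU : ∀ x : tsupport ψ, ∃ U : Set E, Distribution.IsVanishingOn T U ∧ IsOpen U ∧ x.1 ∈ U :=
    fun x => (Distribution.notMem_dsupport_iff x.1).1 (Set.disjoint_left.1 h x.2)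
  choose U hUv hUo hxU using hU
  obtain ⟨t, ht⟩ := hψ.isCompact.elim_nhds_subcover' (fun x hx => U ⟨x, hx⟩)
    (fun x hx => (hUo ⟨x, hx⟩).mem_nhds (hxU ⟨x, hx⟩))
  refine apply_eq_zero_of_tsupport_subset_iUnion hψ (U := fun i : t => U i.1) (fun i => hUo _)
    (fun i => hUv _) (ht.trans ?_)
  exact Set.iUnion₂_subset fun i hi => Set.subset_iUnion (fun i : t => U i.1) ⟨i, hi⟩

/-- A tempered distribution annihilates the Schwartz functions supported away from its support. -/
theorem apply_eq_zero_of_disjoint_dsupport {T : 𝓢'(E, ℂ)} {ψ : 𝓢(E, ℂ)}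
    (h : Disjoint (tsupport ψ) (Distribution.dsupport T)) : T ψ = 0 := by
  obtain ⟨g, hgc, hgs, hg⟩ := exists_seq_hasCompactSupport_tendsto ψ
  have h1 : Tendsto (fun n => T (g n)) atTop (𝓝 (T ψ)) := (T.continuous.tendsto ψ).comp hg
  have h2 : ∀ n, T (g n) = 0 := fun n =>
    apply_eq_zero_of_hasCompactSupport (hgc n) (h.mono_left (hgs n))
  simp_rw [h2] at h1
  exact tendsto_nhds_unique h1 tendsto_const_nhds

/-- The difference `χψ - ψ` vanishes near the support of `T`. This lets `χ` be inserted or removed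
freely when pairing with `u γ`. -/
theorem apply_smulLeftCLM_eq {T : 𝓢'(E, ℂ)} {χ : 𝓢(E, ℂ)}
    (hχ : ∀ x ∈ Distribution.dsupport T, ∀ᶠ y in 𝓝 x, χ y = 1) (ψ : 𝓢(E, ℂ)) :
    T (SchwartzMap.smulLeftCLM ℂ χ ψ) = T ψ := by
  rw [← sub_eq_zero, ← map_sub]
  refine apply_eq_zero_of_disjoint_dsupport (Set.disjoint_right.2 fun x hx => ?_)
  rw [notMem_tsupport_iff_eventuallyEq]
  filter_upwards [hχ x hx] with y hy
  rw [sub_apply, SchwartzMap.smulLeftCLM_apply_apply χ.hasTemperateGrowth, hy,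
    one_smul, sub_self, Pi.zero_apply]

end Cutoff

/-! ### Transposition, and the two bounds between the family and its sum -/

section Duality

open FourierTransform

theorem bracketDS_bracketDS_neg (s : Fin j → ℝ) (φ : 𝓢(Space d, ℂ)) :
    bracketDS d s (bracketDS d (-s) φ) = φ := by
  rw [bracketDS, bracketDS, SchwartzMap.fourierMultiplierCLM_fourierMultiplierCLM_apply
    (symbol_temperate s) (symbol_temperate _), symbol_mul_symbol_neg,
    SchwartzMap.fourierMultiplierCLM_const]
  simp

theorem bracketDS_neg_bracketDS (s : Fin j → ℝ) (φ : 𝓢(Space d, ℂ)) :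
    bracketDS d (-s) (bracketDS d s φ) = φ := by
  simpa using bracketDS_bracketDS_neg (-s) φ

/-- The symbol is even, so the order of `𝓕` and `𝓕⁻` is immaterial; this is what makes the
multiplier equal to its transpose. -/
theorem bracketDS_eq_fourier (s : Fin j → ℝ) (φ : 𝓢(Space d, ℂ)) :
    𝓕 (SchwartzMap.smulLeftCLM ℂ (symbol d s) (𝓕⁻ φ)) = bracketDS d s φ := by
  rw [bracketDS, SchwartzMap.fourierMultiplierCLM_apply]
  ext ξ
  have h : (SchwartzMap.smulLeftCLM ℂ (symbol d s) (𝓕⁻ φ) : Space d → ℂ) =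
      SchwartzMap.smulLeftCLM ℂ (symbol d s) (𝓕 φ) ∘ LinearIsometryEquiv.neg ℝ := by
    ext x
    simp only [Function.comp_apply, LinearIsometryEquiv.coe_neg,
      SchwartzMap.smulLeftCLM_apply_apply (symbol_temperate s), symbol_neg, fourier_neg_apply]
  rw [SchwartzMap.fourier_coe, h, Real.fourier_comp_linearIsometry, ← SchwartzMap.fourier_coe]
  exact fourier_neg_apply _ ξ

/-- `⟨⟨D⟩⟩^s` is its own transpose. -/
theorem bracketD_apply (s : Fin j → ℝ) (T : 𝓢'(Space d, ℂ)) (φ : 𝓢(Space d, ℂ)) :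
    bracketD d s T φ = T (bracketDS d s φ) := by
  rw [bracketD, TemperedDistribution.fourierMultiplierCLM_apply_apply, ← bracketDS_eq_fourier]
  rfl

theorem apply_eq_bracketD_apply (s : Fin j → ℝ) (T : 𝓢'(Space d, ℂ)) (φ : 𝓢(Space d, ℂ)) :
    T φ = bracketD d s T (bracketDS d (-s) φ) := by
  rw [bracketD_apply, bracketDS_bracketDS_neg]

theorem bracketD_bracketD_neg (s : Fin j → ℝ) (T : 𝓢'(Space d, ℂ)) :
    bracketD d s (bracketD d (-s) T) = T := by
  ext φ
  rw [bracketD_apply, bracketD_apply, bracketDS_neg_bracketDS]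

theorem bracketDS_pairing (s : Fin j → ℝ) (φ ψ : 𝓢(Space d, ℂ)) :
    ∫ x, ψ x * bracketDS d s φ x = ∫ x, bracketDS d s ψ x * φ x := by
  have h := DFunLike.congr_fun (TemperedDistribution.fourierMultiplierCLM_toTemperedDistributionCLM_eq
    (symbol_temperate (d := d) s) φ) ψ
  have h2 := bracketD_apply s (SchwartzMap.toTemperedDistributionCLM (Space d) ℂ volume φ) ψ
  exact (SchwartzMap.toTemperedDistributionCLM_apply_apply volume _ ψ).symm.trans
    (h.symm.trans (h2.trans (SchwartzMap.toTemperedDistributionCLM_apply_apply volume φ _)))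

theorem norm_star_Lp (f : Lp ℂ 2 (volume : Measure (Space d))) : ‖star f‖ = ‖f‖ := by
  rw [Lp.norm_def, Lp.norm_def]
  congr 1
  refine eLpNorm_congr_norm_ae ?_
  filter_upwards [Lp.coeFn_star f] with x hx
  rw [hx]
  simp

/-- The distributional pairing is bilinear and the inner product sesquilinear; the `star` reconciles
them, giving access to Cauchy–Schwarz and Riesz. -/
theorem toTemperedDistribution_apply_eq_inner (f : Lp ℂ 2 (volume : Measure (Space d)))
    (g : 𝓢(Space d, ℂ)) : (f : 𝓢'(Space d, ℂ)) g = inner ℂ (star f) (g.toLp 2) := by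
  rw [Lp.toTemperedDistribution_apply, L2.inner_def]
  refine integral_congr_ae ?_
  filter_upwards [Lp.coeFn_star f, g.coeFn_toLp 2 volume] with x hx hg
  rw [hx, hg]
  simp

theorem norm_toTemperedDistribution_apply_le (f : Lp ℂ 2 (volume : Measure (Space d)))
    (g : 𝓢(Space d, ℂ)) : ‖(f : 𝓢'(Space d, ℂ)) g‖ ≤ ‖f‖ * ‖g.toLp 2‖ := by
  rw [toTemperedDistribution_apply_eq_inner, ← norm_star_Lp f]
  exact norm_inner_le_norm _ _

theorem denseRange_toLp_two :
    DenseRange (SchwartzMap.toLpCLM ℂ ℂ 2 (volume : Measure (Space d))).toLinearMap :=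
  SchwartzMap.denseRange_toLpCLM (F := ℂ) ENNReal.ofNat_ne_top

/-- A linear functional on Schwartz functions that is bounded in the `L²` norm is given by an `L²`
function. -/
theorem exists_Lp_of_norm_le (T : 𝓢(Space d, ℂ) →ₗ[ℂ] ℂ) {M : ℝ} (hM : 0 ≤ M)
    (hT : ∀ g, ‖T g‖ ≤ M * ‖g.toLp 2‖) :
    ∃ f : Lp ℂ 2 (volume : Measure (Space d)), ‖f‖ ≤ M ∧ ∀ g, (f : 𝓢'(Space d, ℂ)) g = T g := by
  set ℓ := T.extendOfNorm (SchwartzMap.toLpCLM ℂ ℂ 2 (volume : Measure (Space d))).toLinearMap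
    with hℓ
  refine ⟨star ((InnerProductSpace.toDual ℂ _).symm ℓ), ?_, fun g => ?_⟩
  · rw [norm_star_Lp, LinearIsometryEquiv.norm_map]
    exact LinearMap.opNorm_extendOfNorm_le denseRange_toLp_two hM hT
  · rw [toTemperedDistribution_apply_eq_inner, star_star, InnerProductSpace.toDual_symm_apply]
    exact LinearMap.extendOfNorm_eq denseRange_toLp_two ⟨M, hT⟩ g

/-- A square summable family in `ℋ^s` can be glued to an element of `ℋ^s`. -/
theorem exists_hasSum_of_summable (s : Fin j → ℝ) (χ : 𝓢(Space d, ℂ)) :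
    ∃ C : ℝ, 0 ≤ C ∧ ∀ (u : ((Σ l : Fin j, Fin (d l)) → ℤ) → 𝓢'(Space d, ℂ))
      (f : ((Σ l : Fin j, Fin (d l)) → ℤ) → Lp ℂ 2 (volume : Measure (Space d))),
      (∀ γ, bracketD d s (u γ) = f γ) → (Summable fun γ => ‖f γ‖ ^ 2) →
      ∃ (v : 𝓢'(Space d, ℂ)) (F : Lp ℂ 2 (volume : Measure (Space d))), bracketD d s v = F ∧
        ‖F‖ ≤ C * √(∑' γ, ‖f γ‖ ^ 2) ∧
        ∀ φ, HasSum (fun γ => u γ (SchwartzMap.smulLeftCLM ℂ χ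
          (φ.compSubConstCLM ℂ (-latticePoint γ)))) (v φ) := by
  obtain ⟨C, hC, h⟩ := sum_norm_sq_bracketDS_le (-s) χ
  refine ⟨√C, Real.sqrt_nonneg C, fun u f hf hsum => ?_⟩
  set A := ∑' γ, ‖f γ‖ ^ 2 with hA
  have hA0 : 0 ≤ A := tsum_nonneg fun _ => by positivity
  set t : ((Σ l : Fin j, Fin (d l)) → ℤ) → 𝓢(Space d, ℂ) → ℂ := fun γ φ =>
    u γ (SchwartzMap.smulLeftCLM ℂ χ (φ.compSubConstCLM ℂ (-latticePoint γ))) with ht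
  have hterm : ∀ γ φ, ‖t γ φ‖ ≤ ‖f γ‖ * ‖(bracketDS d (-s) (SchwartzMap.smulLeftCLM ℂ χ
      (φ.compSubConstCLM ℂ (-latticePoint γ)))).toLp 2‖ := fun γ φ => by
    rw [ht]
    simp only
    rw [apply_eq_bracketD_apply s, hf]
    exact norm_toTemperedDistribution_apply_le _ _
  have hfin : ∀ φ (S : Finset ((Σ l : Fin j, Fin (d l)) → ℤ)), ∑ γ ∈ S, ‖t γ φ‖ ≤
      √C * √A * ‖(bracketDS d (-s) φ).toLp 2‖ := fun φ S => by
    refine (Finset.sum_le_sum fun γ _ => hterm γ φ).trans ?_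
    refine abs_le_of_sq_le_sq' ?_ (by positivity) |>.2
    refine (Finset.sum_mul_sq_le_sq_mul_sq _ _ _).trans ?_
    rw [mul_pow, mul_pow, Real.sq_sqrt hC, Real.sq_sqrt hA0, mul_comm C, mul_assoc]
    gcongr
    · exact hsum.sum_le_tsum _ fun _ _ => by positivity
    · exact h φ S
  have hsn : ∀ φ, Summable fun γ => ‖t γ φ‖ := fun φ =>
    summable_of_sum_le (fun _ => norm_nonneg _) (hfin φ)
  have hs : ∀ φ, Summable fun γ => t γ φ := fun φ => (hsn φ).of_norm
  -- Precomposing with `⟨⟨D⟩⟩^s` turns the bound by `‖φ‖_{-s}` into an `L²` bound, so that Riesz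
  -- applies; `⟨⟨D⟩⟩^{-s}` of the resulting `F` is the sum.
  let T : 𝓢(Space d, ℂ) →ₗ[ℂ] ℂ :=
    { toFun := fun φ => ∑' γ, t γ (bracketDS d s φ)
      map_add' := fun φ ψ => by
        rw [← (hs _).tsum_add (hs _)]
        simp only [ht, map_add]
      map_smul' := fun c φ => by
        rw [RingHom.id_apply, smul_eq_mul, ← tsum_mul_left]
        simp only [ht, map_smul, smul_eq_mul] }
  obtain ⟨F, hFn, hF⟩ := exists_Lp_of_norm_le T (M := √C * √A) (by positivity) fun g => by
    refine (norm_tsum_le_tsum_norm (hsn _)).trans ?_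
    have := Real.tsum_le_of_sum_le (fun _ => norm_nonneg _) (hfin (bracketDS d s g))
    rwa [bracketDS_neg_bracketDS] at this
  refine ⟨bracketD d (-s) F, F, bracketD_bracketD_neg s _, hFn, fun φ => ?_⟩
  have : bracketD d (-s) (F : 𝓢'(Space d, ℂ)) φ = ∑' γ, t γ φ := by
    rw [bracketD_apply, hF]
    change ∑' γ, t γ (bracketDS d s (bracketDS d (-s) φ)) = _
    rw [bracketDS_bracketDS_neg]
  rw [this]
  exact (hs φ).hasSum

theorem smulLeftCLM_pairing (χ φ ψ : 𝓢(Space d, ℂ)) :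
    ∫ x, ψ x * SchwartzMap.smulLeftCLM ℂ χ φ x = ∫ x, SchwartzMap.smulLeftCLM ℂ χ ψ x * φ x := by
  refine integral_congr_ae (Filter.Eventually.of_forall fun x => ?_)
  simp only [SchwartzMap.smulLeftCLM_apply_apply χ.hasTemperateGrowth, smul_eq_mul]
  ring

theorem compSubConstCLM_pairing (a : Space d) (φ ψ : 𝓢(Space d, ℂ)) :
    ∫ x, ψ x * φ.compSubConstCLM ℂ (-a) x = ∫ x, ψ.compSubConstCLM ℂ a x * φ x := by
  rw [← integral_sub_right_eq_self _ a]
  refine integral_congr_ae (Filter.Eventually.of_forall fun x => ?_)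
  simp [SchwartzMap.compSubConstCLM_apply]

/-- The localized translates of an element of `ℋ^s` are square summable. -/
theorem exists_sum_norm_sq_le (s : Fin j → ℝ) (χ : 𝓢(Space d, ℂ)) :
    ∃ C : ℝ, 0 ≤ C ∧ ∀ (u : ((Σ l : Fin j, Fin (d l)) → ℤ) → 𝓢'(Space d, ℂ))
      (f : ((Σ l : Fin j, Fin (d l)) → ℤ) → Lp ℂ 2 (volume : Measure (Space d)))
      (v : 𝓢'(Space d, ℂ)) (G : Lp ℂ 2 (volume : Measure (Space d))),
      (∀ γ, bracketD d s (u γ) = f γ) → bracketD d s v = G →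
      (∀ γ φ, u γ φ = v ((SchwartzMap.smulLeftCLM ℂ χ φ).compSubConstCLM ℂ (latticePoint γ))) →
      ∀ S : Finset ((Σ l : Fin j, Fin (d l)) → ℤ), ∑ γ ∈ S, ‖f γ‖ ^ 2 ≤ C * ‖G‖ ^ 2 := by
  obtain ⟨C, hC, h⟩ := sum_norm_sq_bracketDS_le s χ
  refine ⟨C, hC, fun u f v G hf hv huv S => ?_⟩
  let L := (SchwartzMap.toLpCLM ℂ ℂ 2 (volume : Measure (Space d))).toLinearMap
  -- Translation by `-γ` followed by localization, conjugated by `⟨⟨D⟩⟩^s` so as to act on `L²`. Its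
  -- continuous extension `Ā γ` will map `G` to `f γ`, and the square-sum bound passes to all of
  -- `L²` by density.
  let A : ((Σ l : Fin j, Fin (d l)) → ℤ) → 𝓢(Space d, ℂ) →ₗ[ℂ] 𝓢(Space d, ℂ) := fun γ =>
    (bracketDS d s ∘L SchwartzMap.smulLeftCLM ℂ χ ∘L
      SchwartzMap.compSubConstCLM ℂ (-latticePoint γ) ∘L bracketDS d (-s)).toLinearMap
  have hA : ∀ γ g, A γ g = bracketDS d s (SchwartzMap.smulLeftCLM ℂ χ
      ((bracketDS d (-s) g).compSubConstCLM ℂ (-latticePoint γ))) := fun _ _ => rfl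
  have hAS : ∀ g (S : Finset ((Σ l : Fin j, Fin (d l)) → ℤ)),
      ∑ γ ∈ S, ‖L (A γ g)‖ ^ 2 ≤ C * ‖L g‖ ^ 2 := fun g S => by
    have := h (bracketDS d (-s) g) S
    rwa [bracketDS_bracketDS_neg] at this
  have hAb : ∀ γ g, ‖(L ∘ₗ A γ) g‖ ≤ √C * ‖L g‖ := fun γ g => by
    refine abs_le_of_sq_le_sq' ?_ (by positivity) |>.2
    rw [mul_pow, Real.sq_sqrt hC]
    simpa using hAS g {γ}
  let Ā : ((Σ l : Fin j, Fin (d l)) → ℤ) → Lp ℂ 2 (volume : Measure (Space d)) →L[ℂ]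
      Lp ℂ 2 (volume : Measure (Space d)) := fun γ => (L ∘ₗ A γ).extendOfNorm L
  have hĀ : ∀ γ g, Ā γ (L g) = L (A γ g) := fun γ g =>
    LinearMap.extendOfNorm_eq denseRange_toLp_two ⟨√C, hAb γ⟩ g
  have hbound : ∀ f' : Lp ℂ 2 (volume : Measure (Space d)),
      ∑ γ ∈ S, ‖Ā γ f'‖ ^ 2 ≤ C * ‖f'‖ ^ 2 := fun f' => by
    refine denseRange_toLp_two.induction_on f' (isClosed_le (by fun_prop) (by fun_prop)) fun g => ?_
    simp only [show ∀ γ, Ā γ ((SchwartzMap.toLpCLM ℂ ℂ 2 (volume : Measure (Space d))).toLinearMap g)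
      = L (A γ g) from fun γ => hĀ γ g]
    exact hAS g S
  -- The transpose of `Ā γ`: by continuity in `f'` it suffices to treat Schwartz functions, where
  -- each factor of `A γ` is moved across the integral in turn.
  have hpair : ∀ γ (g : 𝓢(Space d, ℂ)) (f' : Lp ℂ 2 (volume : Measure (Space d))),
      (Ā γ f' : 𝓢'(Space d, ℂ)) g = (f' : 𝓢'(Space d, ℂ)) (bracketDS d (-s)
        ((SchwartzMap.smulLeftCLM ℂ χ (bracketDS d s g)).compSubConstCLM ℂ (latticePoint γ))) := by
    intro γ g f'
    have hcont : ∀ g : 𝓢(Space d, ℂ), Continuous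
        fun f' : Lp ℂ 2 (volume : Measure (Space d)) => (f' : 𝓢'(Space d, ℂ)) g := fun g =>
      (PointwiseConvergenceCLM.evalCLM (RingHom.id ℂ) ℂ g).continuous.comp
        (Lp.toTemperedDistributionCLM ℂ (volume : Measure (Space d)) 2).continuous
    refine denseRange_toLp_two.induction_on f'
      (isClosed_eq ((hcont g).comp (Ā γ).continuous) (hcont _)) fun h => ?_
    rw [show Ā γ ((SchwartzMap.toLpCLM ℂ ℂ 2 (volume : Measure (Space d))).toLinearMap h)
      = L (A γ h) from hĀ γ h]
    have hL : ∀ h g : 𝓢(Space d, ℂ), (L h : 𝓢'(Space d, ℂ)) g = ∫ x, g x * h x := fun h g =>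
      (DFunLike.congr_fun (Lp.toTemperedDistribution_toLp_eq (p := 2) h) g).trans
        (SchwartzMap.toTemperedDistributionCLM_apply_apply volume h g)
    refine (hL _ _).trans (Eq.trans ?_ (hL _ _).symm)
    rw [hA, bracketDS_pairing, smulLeftCLM_pairing, compSubConstCLM_pairing, bracketDS_pairing]
  have hfG : ∀ γ, f γ = Ā γ G := fun γ => by
    have hinj : Function.Injective (Lp.toTemperedDistributionCLM ℂ (volume : Measure (Space d)) 2) :=
      LinearMap.ker_eq_bot.1 Lp.ker_toTemperedDistributionCLM_eq_bot
    apply hinj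
    ext g
    rw [Lp.toTemperedDistributionCLM_apply, Lp.toTemperedDistributionCLM_apply, hpair, ← hv,
      ← apply_eq_bracketD_apply, ← huv, ← hf, bracketD_apply]
  simp_rw [hfG]
  exact hbound G

end Duality

/-! ### Discreteness of the lattice and the separating cutoff -/

section Lattice

open Filter Topology

theorem latticePoint_apply (γ : (Σ l : Fin j, Fin (d l)) → ℤ) (i : Σ l : Fin j, Fin (d l)) :
    (latticePoint γ : Space d) i = γ i := rfl

theorem latticePoint_sub (γ γ' : (Σ l : Fin j, Fin (d l)) → ℤ) :
    (latticePoint (γ - γ') : Space d) = latticePoint γ - latticePoint γ' := by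
  ext i
  simp [latticePoint_apply]

theorem latticePoint_eq_zero {γ : (Σ l : Fin j, Fin (d l)) → ℤ} :
    (latticePoint γ : Space d) = 0 ↔ γ = 0 := by
  refine ⟨fun h => ?_, fun h => ?_⟩
  · ext i
    have : (latticePoint γ : Space d) i = 0 := by rw [h]; rfl
    simpa [latticePoint_apply] using this
  · ext i
    simp [latticePoint_apply, h]

theorem one_le_dist_latticePoint {γ γ' : (Σ l : Fin j, Fin (d l)) → ℤ} (h : γ ≠ γ') :
    1 ≤ dist (latticePoint γ : Space d) (latticePoint γ') := by
  obtain ⟨i, hi⟩ := Function.ne_iff.1 h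
  rw [dist_eq_norm, ← latticePoint_sub]
  refine le_trans ?_ (PiLp.norm_apply_le _ i)
  rw [latticePoint_apply, Pi.sub_apply, Real.norm_eq_abs, ← Int.cast_abs]
  exact_mod_cast Int.one_le_abs (sub_ne_zero.2 hi)

theorem isClosed_of_subset_lattice {S : Set (Space d)} (hS : S ⊆ lattice d) : IsClosed S := by
  refine Metric.isClosed_of_pairwise_le_dist one_pos fun x hx y hy hxy => ?_
  obtain ⟨γ, rfl⟩ := hS hx
  obtain ⟨γ', rfl⟩ := hS hy
  exact one_le_dist_latticePoint fun h => hxy (by rw [h])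

theorem finite_setOf_latticePoint_mem {B : Set (Space d)} (hB : IsCompact B) :
    {γ : (Σ l : Fin j, Fin (d l)) → ℤ | latticePoint γ ∈ B}.Finite := by
  obtain ⟨R, hR⟩ := hB.isBounded.exists_norm_le
  refine (Set.finite_Icc (fun _ => -⌈R⌉) (fun _ => ⌈R⌉)).subset fun γ hγ => ?_
  have h : ∀ i, |γ i| ≤ ⌈R⌉ := fun i => by
    have h1 := (PiLp.norm_apply_le (latticePoint γ : Space d) i).trans (hR _ hγ)
    rw [latticePoint_apply, Real.norm_eq_abs, ← Int.cast_abs] at h1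
    exact_mod_cast h1.trans (Int.le_ceil R)
  exact ⟨fun i => (abs_le.1 (h i)).1, fun i => (abs_le.1 (h i)).2⟩

/-- A compact set whose differences avoid the nonzero lattice points has a cutoff function whose
support avoids the other lattice translates of the set. -/
theorem exists_cutoff {K : Set (Space d)} (hK : IsCompact K) (hKK : (K - K) ∩ lattice d = {0}) :
    ∃ χ : 𝓢(Space d, ℂ), HasCompactSupport χ ∧ (∀ x ∈ K, ∀ᶠ y in 𝓝 x, χ y = 1) ∧
      ∀ γ : (Σ l : Fin j, Fin (d l)) → ℤ, γ ≠ 0 → ∀ x ∈ K, x + latticePoint γ ∉ tsupport χ := by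
  -- The nonzero lattice translates of `K` form a closed set, which is disjoint from `K` by the
  -- condition on `K - K`; the cutoff lives in its complement.
  have hcl : IsClosed (K + (lattice d \ {0})) :=
    (isClosed_of_subset_lattice Set.sdiff_subset).add_left_of_isCompact hK
  obtain ⟨χ, hχc, hχV, hχ1⟩ := exists_schwartz_bump hK hcl.isOpen_compl (by
    rintro _ hx ⟨k, hk, δ, ⟨hδ, hδ0⟩, rfl⟩
    refine hδ0 (hKK.subset ⟨?_, hδ⟩)
    exact ⟨k + δ, hx, k, hk, by simp⟩)
  refine ⟨χ, hχc, hχ1, fun γ hγ x hx hmem => hχV hmem ?_⟩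
  exact Set.add_mem_add hx ⟨⟨γ, rfl⟩, fun h => hγ (latticePoint_eq_zero.1 h)⟩

theorem tsupport_compSubConstCLM_subset (a : Space d) (φ : 𝓢(Space d, ℂ)) :
    tsupport (φ.compSubConstCLM ℂ a) ⊆ {x | x - a ∈ tsupport φ} := by
  have h : (φ.compSubConstCLM ℂ a : Space d → ℂ) = φ ∘ fun x => x - a := by
    ext x; simp [SchwartzMap.compSubConstCLM_apply]
  rw [h]
  exact tsupport_comp_subset_preimage φ (by fun_prop)

theorem translate_apply_eq_zero {K : Set (Space d)} {u : 𝓢'(Space d, ℂ)}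
    (hu : Distribution.dsupport u ⊆ K) (a : Space d) (φ : 𝓢(Space d, ℂ))
    (h : ∀ x ∈ K, x + a ∉ tsupport φ) : translate a u φ = 0 := by
  rw [translate_apply_apply]
  refine apply_eq_zero_of_disjoint_dsupport (Set.disjoint_right.2 fun x hx hx' => ?_)
  have := tsupport_compSubConstCLM_subset _ _ hx'
  rw [Set.mem_ofPred_eq, sub_neg_eq_add] at this
  exact h x (hu hx) this

end Lattice

/-! ### Distributional sums of the translates -/

section Sum

theorem tsupport_testToSchwartz_subset (φ : 𝓓((⊤ : TopologicalSpace.Opens (Space d)), ℝ)) :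
    tsupport (testToSchwartz d φ) ⊆ tsupport φ := by
  refine closure_mono fun x hx h0 => hx ?_
  rw [testToSchwartz_apply, h0, Complex.ofReal_zero]

/-- A locally finite family of distributions has a sum. -/
theorem exists_hasDistribSum {ι : Type*} (T : ι → 𝓓'((⊤ : TopologicalSpace.Opens (Space d)), ℂ))
    (hT : ∀ B : Set (Space d), IsCompact B → ∃ S : Finset ι, ∀ i ∉ S,
      ∀ φ : 𝓓((⊤ : TopologicalSpace.Opens (Space d)), ℝ), tsupport φ ⊆ B → T i φ = 0) :
    ∃ U, HasDistribSum T U := by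
  have hsum : ∀ φ, Summable fun i => T i φ := fun φ => by
    obtain ⟨S, hS⟩ := hT _ φ.hasCompactSupport.isCompact
    exact summable_of_ne_finset_zero (s := S) fun i hi => hS i hi φ subset_rfl
  let U : 𝓓'((⊤ : TopologicalSpace.Opens (Space d)), ℂ) :=
    TestFunction.mkCLM ℝ (fun φ => ∑' i, T i φ)
      (fun φ ψ => by simp only [map_add]; exact (hsum φ).tsum_add (hsum ψ))
      (fun c φ => by simp only [map_smul]; exact (hsum φ).tsum_const_smul c)
      (fun B hB => by
        obtain ⟨S, hS⟩ := hT _ B.isCompact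
        -- On test functions supported in a fixed compact set the series is one fixed finite sum,
        -- hence continuous there.
        have h : (fun φ => ∑' i, T i φ) ∘ TestFunction.ofSupportedIn (n := ⊤) hB =
            fun φ => ∑ i ∈ S, T i (TestFunction.ofSupportedIn hB φ) := by
          ext φ
          exact tsum_eq_sum fun i hi => hS i hi _ (by
            exact closure_minimal (fun x hx => by
              by_contra hxB
              exact hx (φ.zero_on_compl hxB)) B.isCompact.isClosed)
        rw [h]
        exact continuous_finsetSum _ fun i _ =>
          (T i).continuous.comp (TestFunction.continuous_ofSupportedIn hB))
  exact ⟨U, fun φ => (hsum φ).hasSum⟩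

theorem exists_testFunctions_of_hasCompactSupport {ψ : 𝓢(Space d, ℂ)} (hψ : HasCompactSupport ψ) :
    ∃ θ₁ θ₂ : 𝓓((⊤ : TopologicalSpace.Opens (Space d)), ℝ),
      ψ = testToSchwartz d θ₁ + Complex.I • testToSchwartz d θ₂ := by
  refine ⟨⟨fun x => (ψ x).re, Complex.reCLM.contDiff.comp (ψ.smooth ⊤),
    hψ.comp_left (g := Complex.re) rfl, fun _ _ => trivial⟩,
    ⟨fun x => (ψ x).im, Complex.imCLM.contDiff.comp (ψ.smooth ⊤),
    hψ.comp_left (g := Complex.im) rfl, fun _ _ => trivial⟩, ?_⟩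
  ext x
  rw [add_apply, smul_apply, testToSchwartz_apply, testToSchwartz_apply, smul_eq_mul, mul_comm]
  exact (Complex.re_add_im _).symm

theorem hasSum_apply_of_hasDistribSum {ι : Type*} {T : ι → 𝓢'(Space d, ℂ)} {v : 𝓢'(Space d, ℂ)}
    (h : HasDistribSum (fun i => toDistribution (T i)) (toDistribution v)) {ψ : 𝓢(Space d, ℂ)}
    (hψ : HasCompactSupport ψ) : HasSum (fun i => T i ψ) (v ψ) := by
  obtain ⟨θ₁, θ₂, rfl⟩ := exists_testFunctions_of_hasCompactSupport hψ
  simp only [map_add, map_smul]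
  exact (h θ₁).add ((h θ₂).const_smul Complex.I)

/-- Test functions determine a tempered distribution: real and imaginary parts reach all compactly
supported Schwartz functions, and these are dense. -/
theorem toDistribution_injective :
    Function.Injective (toDistribution : 𝓢'(Space d, ℂ) → 𝓓'((⊤ : TopologicalSpace.Opens _), ℂ)) := by
  intro v w h
  have hc : ∀ ψ : 𝓢(Space d, ℂ), HasCompactSupport ψ → v ψ = w ψ := fun ψ hψ => by
    obtain ⟨θ₁, θ₂, rfl⟩ := exists_testFunctions_of_hasCompactSupport hψ
    have h' : ∀ θ, v (testToSchwartz d θ) = w (testToSchwartz d θ) := fun θ =>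
      DFunLike.congr_fun h θ
    simp only [map_add, map_smul, h']
  ext ψ
  obtain ⟨g, hgc, -, hg⟩ := exists_seq_hasCompactSupport_tendsto ψ
  have h1 := (v.continuous.tendsto ψ).comp hg
  have h2 := (w.continuous.tendsto ψ).comp hg
  refine tendsto_nhds_unique h1 (h2.congr fun n => ?_)
  exact (hc _ (hgc n)).symm

end Sum

/-- The translates of distributions supported in a fixed compact set are summable. -/
theorem exists_hasDistribSum_translate {K : Set (Space d)} (hK : IsCompact K)
    {u : ((Σ l : Fin j, Fin (d l)) → ℤ) → 𝓢'(Space d, ℂ)}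
    (hu : ∀ γ, Distribution.dsupport (u γ) ⊆ K) :
    ∃ U, HasDistribSum (fun γ => toDistribution (translate (latticePoint γ) (u γ))) U := by
  refine exists_hasDistribSum _ fun B hB => ?_
  -- The translate `K + γ` meets `B` only if `γ ∈ B - K`.
  refine ⟨(finite_setOf_latticePoint_mem (hB.add hK.neg)).toFinset, fun γ hγ φ hφ => ?_⟩
  refine translate_apply_eq_zero (hu γ) _ _ fun x hx hx' => hγ ?_
  rw [Set.Finite.mem_toFinset]
  exact ⟨_, hφ (tsupport_testToSchwartz_subset φ hx'), -x, Set.neg_mem_neg.2 hx, by simp⟩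

/-- The summands are recovered from the sum by localization. -/
theorem apply_eq_of_hasDistribSum {K : Set (Space d)}
    {u : ((Σ l : Fin j, Fin (d l)) → ℤ) → 𝓢'(Space d, ℂ)}
    (hu : ∀ γ, Distribution.dsupport (u γ) ⊆ K) {χ : 𝓢(Space d, ℂ)} (hχ : HasCompactSupport χ)
    (hχ1 : ∀ x ∈ K, ∀ᶠ y in nhds x, χ y = 1)
    (hχ0 : ∀ γ : (Σ l : Fin j, Fin (d l)) → ℤ, γ ≠ 0 → ∀ x ∈ K,
      x + latticePoint γ ∉ tsupport χ) {v : 𝓢'(Space d, ℂ)}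
    (hv : HasDistribSum (fun γ => toDistribution (translate (latticePoint γ) (u γ)))
      (toDistribution v)) (γ : (Σ l : Fin j, Fin (d l)) → ℤ) (φ : 𝓢(Space d, ℂ)) :
    u γ φ = v ((SchwartzMap.smulLeftCLM ℂ χ φ).compSubConstCLM ℂ (latticePoint γ)) := by
  set ψ := (SchwartzMap.smulLeftCLM ℂ χ φ).compSubConstCLM ℂ (latticePoint γ) with hψ
  have hψs : tsupport ψ ⊆ {x | x - latticePoint γ ∈ tsupport χ} := fun x hx =>
    ((SchwartzMap.tsupport_smulLeftCLM_subset _ _).trans Set.inter_subset_right)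
      (tsupport_compSubConstCLM_subset _ _ hx)
  have hψc : HasCompactSupport ψ := by
    refine (hχ.isCompact.image (continuous_add_const (latticePoint γ))).of_isClosed_subset
      (isClosed_tsupport _) fun x hx => ⟨_, hψs hx, by simp⟩
  have h1 := hasSum_apply_of_hasDistribSum hv hψc
  -- Since `ψ` is supported in `γ + supp χ`, which misses `K + γ'` for `γ' ≠ γ`, only one summand
  -- survives.
  have h2 : HasSum (fun γ' => translate (latticePoint γ') (u γ') ψ)
      (translate (latticePoint γ) (u γ) ψ) := by
    refine hasSum_single γ fun γ' hγ' => translate_apply_eq_zero (hu γ') _ _ fun x hx hx' => ?_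
    refine hχ0 (γ' - γ) (sub_ne_zero.2 hγ') x hx ?_
    have := hψs hx'
    rwa [Set.mem_ofPred_eq, add_sub_assoc, ← latticePoint_sub] at this
  rw [h1.unique h2, translate_apply_apply, hψ]
  rw [SchwartzMap.compSubConstCLM_comp]
  simp only [add_neg_cancel, SchwartzMap.compSubConstCLM_zero,
    ContinuousLinearMap.id_apply]
  exact (apply_smulLeftCLM_eq (fun x hx => hχ1 x (hu γ hx)) φ).symm

end AnisotropicSobolev

end

theorem mainTheorem6 {j : ℕ} (hj : 0 < j) (d : Fin j → ℕ) (hd : ∀ l, 0 < d l) (s : Fin j → ℝ)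
    (K : Set (AnisotropicSobolev.Space d)) (hK : IsCompact K)
    (hKK : (K - K) ∩ AnisotropicSobolev.lattice d = {0}) :
    ∃ C : ℝ, 1 ≤ C ∧
      ∀ u : ((Σ l : Fin j, Fin (d l)) → ℤ) → 𝓢'(AnisotropicSobolev.Space d, ℂ),
        (∀ γ, AnisotropicSobolev.MemH s (u γ)) →
        (∀ γ, Distribution.dsupport (u γ) ⊆ K) →
        ∃ U : 𝓓'((⊤ : TopologicalSpace.Opens (AnisotropicSobolev.Space d)), ℂ),
          AnisotropicSobolev.HasDistribSum
            (fun γ => AnisotropicSobolev.toDistribution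
              (AnisotropicSobolev.translate (AnisotropicSobolev.latticePoint γ) (u γ))) U ∧
          ((∃ v : 𝓢'(AnisotropicSobolev.Space d, ℂ),
              AnisotropicSobolev.MemH s v ∧ AnisotropicSobolev.toDistribution v = U) ↔
            Summable fun γ => AnisotropicSobolev.normH s (u γ) ^ 2) ∧
          ∀ v : 𝓢'(AnisotropicSobolev.Space d, ℂ),
            AnisotropicSobolev.MemH s v → AnisotropicSobolev.toDistribution v = U →
              C⁻¹ * AnisotropicSobolev.normH s v ≤
                  Real.sqrt (∑' γ, AnisotropicSobolev.normH s (u γ) ^ 2) ∧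
                Real.sqrt (∑' γ, AnisotropicSobolev.normH s (u γ) ^ 2) ≤
                  C * AnisotropicSobolev.normH s v := by
  open AnisotropicSobolev in
  obtain ⟨χ, hχc, hχ1, hχ0⟩ := exists_cutoff hK hKK
  obtain ⟨C₁, hC₁, h₁⟩ := exists_hasSum_of_summable s χ
  obtain ⟨C₂, hC₂, h₂⟩ := exists_sum_norm_sq_le s χ
  set C := max 1 (max C₁ √C₂) with hC
  have hC1 : 1 ≤ C := le_max_left _ _
  have hCC₁ : C₁ ≤ C := (le_max_left _ _).trans (le_max_right _ _)
  have hCC₂ : √C₂ ≤ C := (le_max_right _ _).trans (le_max_right _ _)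
  refine ⟨C, hC1, fun u hu huK => ?_⟩
  choose f hf using hu
  have hnorm : ∀ γ, normH s (u γ) = ‖f γ‖ := fun γ => normH_eq (hf γ)
  obtain ⟨U, hU⟩ := exists_hasDistribSum_translate hK huK
  have hab : ∀ v G, bracketD d s v = (G : Lp ℂ 2 (volume : Measure (Space d))) →
      toDistribution v = U → ∀ S : Finset ((Σ l : Fin j, Fin (d l)) → ℤ),
      ∑ γ ∈ S, ‖f γ‖ ^ 2 ≤ C₂ * ‖G‖ ^ 2 := fun v G hv hvU =>
    h₂ u f v G hf hv (apply_eq_of_hasDistribSum huK hχc hχ1 hχ0 (hvU ▸ hU))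
  -- The glued distribution pairs through `χ`, but `χ = 1` near `K`, so its restriction to test
  -- functions is `U`.
  have hba : (Summable fun γ => ‖f γ‖ ^ 2) → ∃ (v : 𝓢'(Space d, ℂ))
      (G : Lp ℂ 2 (volume : Measure (Space d))), bracketD d s v = G ∧
      ‖G‖ ≤ C₁ * √(∑' γ, ‖f γ‖ ^ 2) ∧ toDistribution v = U := fun hsum => by
    obtain ⟨v, G, hv, hG, hvsum⟩ := h₁ u f hf hsum
    refine ⟨v, G, hv, hG, ?_⟩
    ext φ
    refine (hvsum (testToSchwartz d φ)).unique ?_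
    have h3 := hU φ
    convert h3 using 2 with γ
    exact apply_smulLeftCLM_eq (fun x hx => hχ1 x (huK γ hx)) _
  have hsum_of : ∀ v G, bracketD d s v = (G : Lp ℂ 2 (volume : Measure (Space d))) →
      toDistribution v = U → Summable fun γ => ‖f γ‖ ^ 2 := fun v G hv hvU =>
    summable_of_sum_le (fun _ => by positivity) (hab v G hv hvU)
  simp_rw [hnorm]
  refine ⟨U, hU, ⟨fun ⟨v, ⟨G, hv⟩, hvU⟩ => hsum_of v G hv hvU, fun hsum => ?_⟩,
    fun v ⟨G, hv⟩ hvU => ?_⟩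
  · obtain ⟨v, G, hv, -, hvU⟩ := hba hsum
    exact ⟨v, ⟨G, hv⟩, hvU⟩
  · rw [normH_eq hv]
    constructor
    · obtain ⟨w, H, hw, hH, hwU⟩ := hba (hsum_of v G hv hvU)
      obtain rfl : w = v := toDistribution_injective (hwU.trans hvU.symm)
      have hGH : ‖G‖ = ‖H‖ := by rw [← normH_eq hv, ← normH_eq hw]
      rw [inv_mul_le_iff₀ (by positivity), hGH]
      exact hH.trans (by gcongr)
    · calc √(∑' γ, ‖f γ‖ ^ 2) ≤ √(C₂ * ‖G‖ ^ 2) := Real.sqrt_le_sqrt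
            (Real.tsum_le_of_sum_le (fun _ => by positivity) (hab v G hv hvU))
        _ = √C₂ * ‖G‖ := by rw [Real.sqrt_mul hC₂, Real.sqrt_sq (norm_nonneg _)]
        _ ≤ C * ‖G‖ := by gcongr
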